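/- **Setting.** A binary-input output-symmetric (BIOS) memoryless channel has input alphabet $\mathbb F_2$, an output alphabet $\mathcal Y$ (discrete or continuous) and conditional probability mass or density functions $P(y|x)$, $x\in\mathbb F_2$, with respect to a reference measure on $\mathcal Y$ (counting measure in the discrete case), such that $P(y|1)=P(\pi(y)|0)$ for all $y\in\mathcal Y$, where $\pi:\mathcal Y\to\mathcal Y$ satisfies $\pi(\pi(y))=y$ and preserves the reference measure. Its capacity is $C_{\mathrm{BIOS}}=\sup_{P_X} I(X;Y)$, the supremum being over all distributions of $X$ on $\mathbb F_2$. All information quantities are in bits. Let $n\ge 1$ and let $\mathscr C_0[n,k]\subseteq\mathbb F_2^n$ be a binary linear code of dimension $k$ (the payload code) with a bijective encoder $\mathbb F_2^k\to\mathscr C_0$. For $L\ge1$, let the payload data $U^{(0)},\dots,U^{(L-1)}$ be independent and uniformly distributed on $\mathbb F_2^k$, and let $c\in\mathbb F_2^{nL}$ be the concatenation of the $L$ corresponding codewords. Independently, $k_1$ extra bits $V$, uniformly distributed on $\mathbb F_2^{k_1}$, are encoded into a word $w\in\mathbb F_2^{nL}$ by an encoding function $\mathscr C_1:\mathbb F_2^{k_1}\to\mathbb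 F_2^{nL}$ of rate $k_1/(nL)$. The sequence $x=c+w$ is sent over the channel, and a decoder $\psi_1$, which sees only the received sequence $y\in\mathcal Y^{nL}$, produces an estimate $\widehat V=\psi_1(y)$; put $\lambda_1^{(L)}=\Pr\{\widehat V\ne V\}$. A rate $R_1$ is *accessible* if there is a sequence of pairs $(\mathscr C_1,\psi_1)$, one for each $L$, with rates at least $R_1$ and $\lim_{L\to\infty}\lambda_1^{(L)}=0$. The *accessible capacity* $C_a$ is the supremum of all accessible rates. **Theorem.** The accessible capacity is $$C_a=C_{\mathrm{BIOS}}-\frac1n\, I(\bm C^n;\widetilde{\bm Y}^n),$$ where $I(\bm C^n;\widetilde{\bm Y}^n)$ is the mutual information between the codeword $\bm C^n\in\mathscr C_0$ of a uniformly distributed data block and the sequence $\widetilde{\bm Y}^n\in\mathcal Y^n$ received when $\bm C^n$ itself is sent over the channel (no extra bits). Both information quantities are finite. The same value is obtained if the encoding functions $\mathscr C_1$ are required to be injective and linear, i.e. if only linear codes of length $nL$ and dimension $k_1$ are admitted. -/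

import Mathlib

open MeasureTheory Filter Topology InformationTheory
open scoped ENNReal

namespace FreeRide

/-- A binary-input output-symmetric (BIOS) channel with output alphabet `Y`. The transition law is
given by probability mass/density functions `P(y|x)` with respect to a reference measure `ref` on
`Y`: counting measure for a discrete channel, Lebesgue measure for a continuous one. The mapping
`flip` is the involution `π` of the symmetry condition `P(y|1) = P(π(y)|0)`; it preserves `ref`
(automatic for counting measure, and true for `y ↦ -y` on the real line). -/
structure BIOSChannel (Y : Type*) [MeasurableSpace Y] where
  ref : Measure Y
  density : ZMod 2 → Y → ℝ≥0∞
  measurable_density : ∀ x, Measurable (density x)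
  lintegral_density : ∀ x, ∫⁻ y, density x y ∂ref = 1
  flip : Y → Y
  flip_flip : ∀ y, flip (flip y) = y
  measurePreserving_flip : MeasurePreserving flip ref ref
  symmetry : ∀ y, density 1 y = density 0 (flip y)

section Information

variable {A B : Type*} [Fintype A] [MeasurableSpace A] [MeasurableSpace B]

/-- The joint law of `(X, Y)` when `X` has law `p` on a finite set and `Y` has conditional law
`W x` given `X = x`. -/
noncomputable def jointLaw (p : PMF A) (W : A → Measure B) : Measure (A × B) :=
  ∑ x, p x • (Measure.dirac x).prod (W x)

/-- The mutual information, in bits, of a pair with joint law `J`: the Kullback-Leibler divergence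
of the joint law from the product of its two marginals. -/
noncomputable def mutualInfo (J : Measure (A × B)) : ℝ≥0∞ :=
  klDiv J (J.fst.prod J.snd) / ENNReal.ofReal (Real.log 2)

end Information

namespace BIOSChannel

variable {Y : Type*} [MeasurableSpace Y] (ch : BIOSChannel Y)

/-- The law of the output symbol when the input symbol is `x`. -/
noncomputable def law (x : ZMod 2) : Measure Y :=
  ch.ref.withDensity (ch.density x)

/-- The law of the output sequence when the sequence `x` is sent: the channel is memoryless. -/
noncomputable def seqLaw {ι : Type*} [Fintype ι] (x : ι → ZMod 2) : Measure (ι → Y) :=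
  Measure.pi fun i => ch.law (x i)

/-- The channel capacity, in bits per channel use: the supremum of the mutual information between
input and output over all input distributions. -/
noncomputable def capacity : ℝ≥0∞ :=
  ⨆ p : PMF (ZMod 2), mutualInfo (jointLaw p ch.law)

/-- `I(C^n; Ỹ^n)`, in bits: the mutual information between the codeword `C^n` of a uniformly
distributed data block and the sequence received when this codeword is sent over the channel. -/
noncomputable def payloadInfo {n k : ℕ} {C₀ : Submodule (ZMod 2) (Fin n → ZMod 2)}
    (enc : (Fin k → ZMod 2) ≃ C₀) : ℝ≥0∞ :=
  mutualInfo (jointLaw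
    ((PMF.uniformOfFintype (Fin k → ZMod 2)).map fun u => (enc u : Fin n → ZMod 2)) ch.seqLaw)

end BIOSChannel

/-- The codeword sequence `c = (c^(0), …, c^(L-1))` of the data blocks `u^(0), …, u^(L-1)`. The
`n * L` coordinates are indexed by pairs (block number, position in the block). -/
def payloadCodeword {n k : ℕ} {C₀ : Submodule (ZMod 2) (Fin n → ZMod 2)}
    (enc : (Fin k → ZMod 2) ≃ C₀) {L : ℕ} (u : Fin L → Fin k → ZMod 2) :
    Fin L × Fin n → ZMod 2 :=
  fun ti => (enc (u ti.1) : Fin n → ZMod 2) ti.2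

/-- An encoder of `k₁` extra bits into a binary word of length `n * L`, together with a decoder
which estimates the extra bits from the received sequence. -/
structure FreeRideCode (n L k₁ : ℕ) (Y : Type*) [MeasurableSpace Y] where
  encode : (Fin k₁ → ZMod 2) → (Fin L × Fin n → ZMod 2)
  decode : (Fin L × Fin n → Y) → (Fin k₁ → ZMod 2)
  measurableSet_decode : ∀ v, MeasurableSet {y | decode y = v}

namespace FreeRideCode

variable {n L k₁ : ℕ} {Y : Type*} [MeasurableSpace Y]

/-- The code is a linear code of dimension `k₁`. -/
def IsLinear (S : FreeRideCode n L k₁ Y) : Prop :=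
  IsLinearMap (ZMod 2) S.encode ∧ Function.Injective S.encode

/-- The word error rate `Pr{V̂ ≠ V}` of the extra bits when `x = c + w` is sent, the payload data
and the extra bits being independent and uniformly distributed. -/
noncomputable def errorRate (S : FreeRideCode n L k₁ Y) (ch : BIOSChannel Y) {k : ℕ}
    {C₀ : Submodule (ZMod 2) (Fin n → ZMod 2)} (enc : (Fin k → ZMod 2) ≃ C₀) : ℝ :=
  (∑ u : Fin L → Fin k → ZMod 2, ∑ v : Fin k₁ → ZMod 2,
    (ch.seqLaw (payloadCodeword enc u + S.encode v)).real {y | S.decode y ≠ v}) /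
      (2 ^ (k * L) * 2 ^ k₁)

end FreeRideCode

section Accessible

variable {Y : Type*} [MeasurableSpace Y] (ch : BIOSChannel Y) {n k : ℕ}
  {C₀ : Submodule (ZMod 2) (Fin n → ZMod 2)} (enc : (Fin k → ZMod 2) ≃ C₀)

/-- The rates which are accessible for the extra transmission. -/
def accessibleRates : Set ℝ :=
  {R | ∃ (k₁ : ℕ → ℕ) (S : ∀ L, FreeRideCode n L (k₁ L) Y),
    (∀ L, 0 < L → R ≤ (k₁ L : ℝ) / (n * L)) ∧
    Tendsto (fun L => (S L).errorRate ch enc) atTop (𝓝 0)}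

/-- The rates which are accessible for the extra transmission by means of linear codes of length
`n * L` and dimension `k₁`. -/
def linearAccessibleRates : Set ℝ :=
  {R | ∃ (k₁ : ℕ → ℕ) (S : ∀ L, FreeRideCode n L (k₁ L) Y),
    (∀ L, (S L).IsLinear) ∧
    (∀ L, 0 < L → R ≤ (k₁ L : ℝ) / (n * L)) ∧
    Tendsto (fun L => (S L).errorRate ch enc) atTop (𝓝 0)}

end Accessible

end FreeRide

/-! Take as reference the output law `mixture` of a uniform input bit. Relative to it both
transition densities are at most 2 and sum to 2, so every divergence below is finite. The involution
preserves the reference and exchanges the two densities, so both have the same divergence from it, E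
nats. Mutual information is the mean divergence of the conditional laws from the reference minus the
divergence of the output law. Hence E is the capacity in nats, and the payload information is nE -
D, where D is the divergence of the output of a random payload codeword from n uniform outputs.
Therefore the claimed value is D / (n log 2) (`capacity_sub_payloadInfo`).

The extra bits see a channel from w to the output sequence in which the payload acts as noise. Its
density `blockDensity` at w = 0 is a product of L copies of the payload density, and flipping the
outputs where w is 1 carries it to any other w. So each word w has divergence LD from the reference,
and this governs both directions.

Converse: a Fano-type bound compares the disjoint decision regions with the reference measure, whose
values on them sum to at most 1 (`log_two_mul_le`). Achievability: decode by a threshold T slightly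
below exp(LD). By Chebyshev the true word rarely falls below T. Under a random linear encoder the
difference of two distinct messages has a uniform image, and the densities of all words average to
1, so a given wrong word reaches T with probability at most 1/T on average. The expected number of
nonzero kernel vectors is small too, so one encoder is both injective and reliable
(`exists_isLinear_errorRate_le`). -/

namespace FreeRide

/-! ### Relative entropy of bounded densities. -/

section Entropy

variable {α : Type*} [MeasurableSpace α]

/-- The relative entropy, in nats, of the measure with density `h` from `ν`. -/
noncomputable def densityEntropy (ν : Measure α) (h : α → ℝ) : ℝ :=
  ∫ y, h y * Real.log (h y) ∂ν

/-- A bounded probability density with respect to `ν`. -/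
structure IsBoundedDensity (ν : Measure α) (h : α → ℝ) (B : ℝ) : Prop where
  measurable : Measurable h
  nonneg : ∀ y, 0 ≤ h y
  le_bound : ∀ y, h y ≤ B
  integral_eq_one : ∫ y, h y ∂ν = 1

variable {ν : Measure α}

/-- The values lie in the compact interval [0, B], on which a continuous function is bounded. All
integrability of logarithmic terms rests on this. -/
theorem IsBoundedDensity.integrable_comp [IsFiniteMeasure ν] {h : α → ℝ} {B : ℝ}
    (hh : IsBoundedDensity ν h B) {φ : ℝ → ℝ} (hφ : Continuous φ) :
    Integrable (fun y => φ (h y)) ν := by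
  obtain ⟨C, hC⟩ := (isCompact_Icc (a := (0 : ℝ)) (b := B)).exists_bound_of_continuousOn
    hφ.continuousOn
  exact Integrable.of_bound (hφ.measurable.comp hh.measurable).aestronglyMeasurable C
    (ae_of_all _ fun y => hC _ ⟨hh.nonneg y, hh.le_bound y⟩)

theorem IsBoundedDensity.integrable [IsFiniteMeasure ν] {h : α → ℝ} {B : ℝ}
    (hh : IsBoundedDensity ν h B) : Integrable h ν :=
  hh.integrable_comp continuous_id

theorem IsBoundedDensity.integrable_mul_log [IsFiniteMeasure ν] {h : α → ℝ} {B : ℝ}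
    (hh : IsBoundedDensity ν h B) : Integrable (fun y => h y * Real.log (h y)) ν :=
  hh.integrable_comp Real.continuous_mul_log

/-- Passing to the square root of |t| halves the logarithm and reduces the claim to continuity of t
log t. It serves to make the variance of the log-likelihood finite. -/
theorem continuous_mul_log_sq : Continuous fun t : ℝ => |t| * Real.log t ^ 2 := by
  have h : (fun t : ℝ => |t| * Real.log t ^ 2) =
      fun t => 4 * (Real.sqrt |t| * Real.log (Real.sqrt |t|)) ^ 2 := by
    funext t
    rw [Real.log_sqrt (abs_nonneg t), Real.log_abs, mul_pow, Real.sq_sqrt (abs_nonneg t)]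
    ring
  rw [h]
  exact continuous_const.mul ((Real.continuous_mul_log.comp
    (Real.continuous_sqrt.comp continuous_abs)).pow 2)

theorem IsBoundedDensity.integrable_mul_log_sq [IsFiniteMeasure ν] {h : α → ℝ} {B : ℝ}
    (hh : IsBoundedDensity ν h B) : Integrable (fun y => h y * Real.log (h y) ^ 2) ν := by
  have := hh.integrable_comp continuous_mul_log_sq
  simpa only [abs_of_nonneg (hh.nonneg _)] using this

theorem IsBoundedDensity.isProbabilityMeasure [IsFiniteMeasure ν] {h : α → ℝ} {B : ℝ}
    (hh : IsBoundedDensity ν h B) :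
    IsProbabilityMeasure (ν.withDensity fun y => ENNReal.ofReal (h y)) := by
  constructor
  rw [withDensity_apply _ MeasurableSet.univ, Measure.restrict_univ,
    ← ofReal_integral_eq_lintegral_ofReal hh.integrable (ae_of_all _ hh.nonneg),
    hh.integral_eq_one, ENNReal.ofReal_one]

theorem IsBoundedDensity.withDensity_real [IsFiniteMeasure ν] {h : α → ℝ} {B : ℝ}
    (hh : IsBoundedDensity ν h B) {s : Set α} (hs : MeasurableSet s) :
    (ν.withDensity fun y => ENNReal.ofReal (h y)).real s = ∫ y in s, h y ∂ν := by
  rw [Measure.real, withDensity_apply _ hs,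
    ← ofReal_integral_eq_lintegral_ofReal hh.integrable.integrableOn (ae_of_all _ hh.nonneg),
    ENNReal.toReal_ofReal (integral_nonneg hh.nonneg)]

theorem IsBoundedDensity.integral_withDensity {h : α → ℝ} {B : ℝ}
    (hh : IsBoundedDensity ν h B) (k : α → ℝ) :
    ∫ y, k y ∂(ν.withDensity fun y => ENNReal.ofReal (h y)) = ∫ y, h y * k y ∂ν := by
  rw [integral_withDensity_eq_integral_toReal_smul hh.measurable.ennreal_ofReal
    (ae_of_all _ fun _ => ENNReal.ofReal_lt_top)]
  simp [ENNReal.toReal_ofReal (hh.nonneg _)]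

theorem IsBoundedDensity.sum {ι : Type*} [Fintype ι] [IsFiniteMeasure ν] {h : ι → α → ℝ} {B : ℝ}
    (hh : ∀ i, IsBoundedDensity ν (h i) B) {p : ι → ℝ} (hp : ∀ i, 0 ≤ p i) (hp1 : ∑ i, p i = 1) :
    IsBoundedDensity ν (fun y => ∑ i, p i * h i y) B where
  measurable := Finset.measurable_fun_sum _ fun i _ => (hh i).measurable.const_mul _
  nonneg y := Finset.sum_nonneg fun i _ => mul_nonneg (hp i) ((hh i).nonneg y)
  le_bound y := calc
    ∑ i, p i * h i y ≤ ∑ i, p i * B :=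
      Finset.sum_le_sum fun i _ => mul_le_mul_of_nonneg_left ((hh i).le_bound y) (hp i)
    _ = B := by rw [← Finset.sum_mul, hp1, one_mul]
  integral_eq_one := by
    rw [integral_finsetSum _ fun i _ => (hh i).integrable.const_mul _]
    simp [integral_const_mul, (hh _).integral_eq_one, hp1]

/-- Young's inequality for the conjugate pair t log t - t and exp s. With s = 0 it gives
nonnegativity of divergence; with s the logarithm of the number of messages it gives the Fano bound.
-/
theorem mul_log_ge (t s : ℝ) (ht : 0 ≤ t) : t * s + t - Real.exp s ≤ t * Real.log t := by
  rcases ht.eq_or_lt with rfl | ht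
  · simp [Real.exp_nonneg]
  have := Real.add_one_le_exp (s - Real.log t)
  rw [Real.exp_sub, Real.exp_log ht, le_div_iff₀ ht] at this
  nlinarith

theorem IsBoundedDensity.densityEntropy_nonneg [IsProbabilityMeasure ν] {h : α → ℝ} {B : ℝ}
    (hh : IsBoundedDensity ν h B) : 0 ≤ densityEntropy ν h := by
  have h1 : ∫ y, (h y - 1) ∂ν ≤ densityEntropy ν h :=
    integral_mono (hh.integrable.sub (integrable_const 1)) hh.integrable_mul_log fun y => by
      simpa using mul_log_ge (h y) 0 (hh.nonneg y)
  rw [integral_sub hh.integrable (integrable_const 1), hh.integral_eq_one] at h1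
  simpa using h1

theorem IsBoundedDensity.densityEntropy_le [IsFiniteMeasure ν] {h : α → ℝ} {B : ℝ}
    (hh : IsBoundedDensity ν h B) : densityEntropy ν h ≤ Real.log B := by
  have h1 : densityEntropy ν h ≤ ∫ y, h y * Real.log B ∂ν :=
    integral_mono hh.integrable_mul_log (hh.integrable.mul_const _) fun y => by
      rcases (hh.nonneg y).eq_or_lt with h0 | h0
      · simp [← h0]
      · exact mul_le_mul_of_nonneg_left (Real.log_le_log h0 (hh.le_bound y)) h0.le
  rwa [integral_mul_const, hh.integral_eq_one, one_mul] at h1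

theorem densityEntropy_sum_le {ι : Type*} [Fintype ι] [IsFiniteMeasure ν] {h : ι → α → ℝ} {B : ℝ}
    (hh : ∀ i, IsBoundedDensity ν (h i) B) {p : ι → ℝ} (hp : ∀ i, 0 ≤ p i) (hp1 : ∑ i, p i = 1) :
    densityEntropy ν (fun y => ∑ i, p i * h i y) ≤ ∑ i, p i * densityEntropy ν (h i) := by
  simp_rw [densityEntropy, ← integral_const_mul]
  rw [← integral_finsetSum _ fun i _ => (hh i).integrable_mul_log.const_mul _]
  exact integral_mono (IsBoundedDensity.sum hh hp hp1).integrable_mul_log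
    (integrable_finsetSum _ fun i _ => (hh i).integrable_mul_log.const_mul _) fun y =>
      Real.convexOn_mul_log.map_sum_le (fun i _ => hp i) hp1 fun i _ => (hh i).nonneg y

theorem densityEntropy_comp {g : α → α} (hg : MeasurePreserving g ν ν) {h : α → ℝ}
    (hh : Measurable h) : densityEntropy ν (fun y => h (g y)) = densityEntropy ν h := by
  have := integral_map (μ := ν) hg.measurable.aemeasurable
    (hh.mul hh.log).aestronglyMeasurable
  rw [hg.map_eq] at this
  exact this.symm

/-- Domination of f by K g makes f vanish where g does and makes f log g integrable. The affine part
of `klFun` contributes the integral of g - f, which is zero. -/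
theorem lintegral_klFun_div [IsFiniteMeasure ν] {f g : α → ℝ} {B B' K : ℝ}
    (hf : IsBoundedDensity ν f B) (hg : IsBoundedDensity ν g B') (hK : 0 ≤ K)
    (hfg : ∀ y, f y ≤ K * g y) :
    ∫⁻ y, ENNReal.ofReal (klFun (f y / g y)) ∂(ν.withDensity fun y => ENNReal.ofReal (g y)) =
        ENNReal.ofReal (∫ y, (f y * Real.log (f y) - f y * Real.log (g y)) ∂ν) ∧
      0 ≤ ∫ y, (f y * Real.log (f y) - f y * Real.log (g y)) ∂ν := by
  have hint : Integrable (fun y => f y * Real.log (g y)) ν := by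
    refine (hg.integrable_mul_log.const_mul K).mono
      (hf.measurable.mul hg.measurable.log).aestronglyMeasurable (ae_of_all _ fun y => ?_)
    rw [norm_mul, norm_mul, norm_mul, ← mul_assoc]
    refine mul_le_mul_of_nonneg_right ?_ (norm_nonneg _)
    rw [Real.norm_of_nonneg (hf.nonneg y), Real.norm_of_nonneg hK,
      Real.norm_of_nonneg (hg.nonneg y)]
    exact hfg y
  have hint2 : Integrable (fun y => f y * Real.log (f y) - f y * Real.log (g y)) ν :=
    hf.integrable_mul_log.sub hint
  have hint3 : Integrable (fun y => g y - f y) ν := hg.integrable.sub hf.integrable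
  have hpt : ∀ y, g y * klFun (f y / g y) =
      f y * Real.log (f y) - f y * Real.log (g y) + (g y - f y) := fun y => by
    rcases (hg.nonneg y).eq_or_lt with h0 | h0
    · have : f y = 0 := le_antisymm (by simpa [← h0] using hfg y) (hf.nonneg y)
      simp [← h0, this]
    rcases (hf.nonneg y).eq_or_lt with h1 | h1
    · simp [← h1, klFun]
    rw [klFun, Real.log_div h1.ne' h0.ne']
    field_simp
    ring
  have hnn : ∀ y, 0 ≤ g y * klFun (f y / g y) := fun y =>
    mul_nonneg (hg.nonneg y) (klFun_nonneg (div_nonneg (hf.nonneg y) (hg.nonneg y)))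
  have hI : ∫ y, g y * klFun (f y / g y) ∂ν =
      ∫ y, (f y * Real.log (f y) - f y * Real.log (g y)) ∂ν := by
    simp_rw [hpt]
    rw [integral_add hint2 hint3,
      integral_sub hg.integrable hf.integrable, hf.integral_eq_one, hg.integral_eq_one]
    simp
  refine ⟨?_, hI ▸ integral_nonneg hnn⟩
  rw [← hI, ofReal_integral_eq_lintegral_ofReal _ (ae_of_all _ hnn),
    lintegral_withDensity_eq_lintegral_mul _ hg.measurable.ennreal_ofReal
      (by have := hf.measurable; have := hg.measurable; fun_prop)]
  · simp [ENNReal.ofReal_mul (hg.nonneg _)]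
  · simp_rw [hpt]
    exact hint2.add hint3

end Entropy

/-! ### Mutual information as a difference of relative entropies. -/

section MutualInformation

theorem sum_toReal_pmf {A : Type*} [Fintype A] (p : PMF A) : ∑ a, (p a).toReal = 1 := by
  rw [← ENNReal.toReal_sum fun a _ => p.apply_ne_top a, ← tsum_fintype (L := .unconditional A),
    p.tsum_coe, ENNReal.toReal_one]

variable {A B : Type*} [Fintype A] [MeasurableSpace A] [MeasurableSpace B]

theorem jointLaw_apply (p : PMF A) (W : A → Measure B) [∀ a, SFinite (W a)] {s : Set (A × B)}
    (hs : MeasurableSet s) : jointLaw p W s = ∑ a, p a * W a (Prod.mk a ⁻¹' s) := by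
  simp [jointLaw, Measure.dirac_prod, Measure.map_apply measurable_prodMk_left hs]

theorem fst_jointLaw (p : PMF A) (W : A → Measure B) [∀ a, IsProbabilityMeasure (W a)] :
    (jointLaw p W).fst = ∑ a, p a • Measure.dirac a := by
  classical
  ext s hs
  rw [Measure.fst_apply hs, jointLaw_apply _ _ (measurable_fst hs), Measure.finsetSum_apply]
  refine Finset.sum_congr rfl fun a _ => ?_
  by_cases h : a ∈ s <;> simp [← Set.preimage_comp, Function.comp_def, Measure.dirac_apply' _ hs, h]

theorem snd_jointLaw (p : PMF A) (W : A → Measure B) [∀ a, SFinite (W a)] :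
    (jointLaw p W).snd = ∑ a, p a • W a := by
  ext s hs
  rw [Measure.snd_apply hs, jointLaw_apply _ _ (measurable_snd hs), Measure.finsetSum_apply]
  simp [← Set.preimage_comp, Function.comp_def]

variable [MeasurableSingletonClass A]

/-- The joint law has density h a / m with respect to the product of its marginals, m being the
output density. Expanding the logarithm of the quotient and summing the m-terms over a collects them
into the divergence of m. Letters of probability zero are set aside, since only for the others is h
a dominated by a multiple of m. -/
theorem mutualInfo_jointLaw {ν : Measure B} [IsProbabilityMeasure ν] (p : PMF A)
    {W : A → Measure B} {h : A → B → ℝ} {K : ℝ} (hh : ∀ a, IsBoundedDensity ν (h a) K)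
    (hW : ∀ a, W a = ν.withDensity fun y => ENNReal.ofReal (h a y)) :
    mutualInfo (jointLaw p W) = ENNReal.ofReal
      ((∑ a, (p a).toReal * densityEntropy ν (h a) -
        densityEntropy ν fun y => ∑ a, (p a).toReal * h a y) / Real.log 2) := by
  have hprob : ∀ a, IsProbabilityMeasure (W a) := fun a => hW a ▸ (hh a).isProbabilityMeasure
  set m : B → ℝ := fun y => ∑ a, (p a).toReal * h a y with hm
  have hmd : IsBoundedDensity ν m K :=
    IsBoundedDensity.sum hh (fun _ => ENNReal.toReal_nonneg) (sum_toReal_pmf p)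
  have hle : ∀ a y, (p a).toReal * h a y ≤ m y := fun a y =>
    Finset.single_le_sum (f := fun a => (p a).toReal * h a y)
      (fun a _ => mul_nonneg ENNReal.toReal_nonneg ((hh a).nonneg y)) (Finset.mem_univ a)
  have hsnd : (jointLaw p W).snd = ν.withDensity fun y => ENNReal.ofReal (m y) := by
    rw [snd_jointLaw]
    ext s hs
    rw [Measure.finsetSum_apply, withDensity_apply _ hs]
    simp_rw [hm, ENNReal.ofReal_sum_of_nonneg fun a _ =>
      mul_nonneg (ENNReal.toReal_nonneg (a := p a)) ((hh a).nonneg _)]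
    rw [lintegral_finsetSum _ fun a _ => ((hh a).measurable.const_mul _).ennreal_ofReal]
    refine Finset.sum_congr rfl fun a _ => ?_
    simp_rw [ENNReal.ofReal_mul (ENNReal.toReal_nonneg (a := p a)),
      ENNReal.ofReal_toReal (p.apply_ne_top a)]
    rw [lintegral_const_mul _ (hh a).measurable.ennreal_ofReal, Measure.smul_apply, hW,
      withDensity_apply _ hs, smul_eq_mul]
  have hmprob := hmd.isProbabilityMeasure
  rw [← hsnd] at hmprob
  have hlint : ∀ F : A × B → ℝ≥0∞, Measurable F →
      ∫⁻ z, F z ∂((jointLaw p W).fst.prod (jointLaw p W).snd) =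
        ∑ a, p a * ∫⁻ y, F (a, y) ∂(jointLaw p W).snd := fun F hF => by
    rw [lintegral_prod _ hF.aemeasurable, fst_jointLaw, lintegral_finsetSum_measure]
    simp
  have hfstprob : IsProbabilityMeasure (jointLaw p W).fst := by
    constructor
    rw [fst_jointLaw, Measure.finsetSum_apply]
    simpa [tsum_fintype] using p.tsum_coe
  have hquot : ∀ a, Measurable fun y => ENNReal.ofReal (h a y / m y) := fun a =>
    ((hh a).measurable.div hmd.measurable).ennreal_ofReal
  have hrm : Measurable fun z : A × B => ENNReal.ofReal (h z.1 z.2 / m z.2) :=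
    measurable_from_prod_countable_right hquot
  have hpa : ∀ a, p a ≠ 0 → 0 < (p a).toReal := fun a h0 =>
    ENNReal.toReal_pos h0 (p.apply_ne_top a)
  have hle' : ∀ a, p a ≠ 0 → ∀ y, h a y ≤ (p a).toReal⁻¹ * m y := fun a h0 y => by
    rw [inv_mul_eq_div, le_div_iff₀ (hpa a h0), mul_comm]
    exact hle a y
  have hJ : jointLaw p W = ((jointLaw p W).fst.prod (jointLaw p W).snd).withDensity
      fun z => ENNReal.ofReal (h z.1 z.2 / m z.2) := by
    ext s hs
    rw [jointLaw_apply _ _ hs, withDensity_apply _ hs, ← lintegral_indicator hs,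
      hlint _ (hrm.indicator hs)]
    refine Finset.sum_congr rfl fun a _ => ?_
    by_cases h0 : p a = 0
    · simp [h0]
    congr 1
    have hs' : MeasurableSet (Prod.mk a ⁻¹' s) := measurable_prodMk_left hs
    have : ∀ y, s.indicator (fun z : A × B => ENNReal.ofReal (h z.1 z.2 / m z.2)) (a, y) =
        (Prod.mk a ⁻¹' s).indicator (fun y => ENNReal.ofReal (h a y / m y)) y := fun y => rfl
    simp_rw [this]
    rw [lintegral_indicator hs', hW, hsnd, withDensity_apply _ hs',
      setLIntegral_withDensity_eq_setLIntegral_mul _ hmd.measurable.ennreal_ofReal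
        (hquot a) hs']
    refine lintegral_congr fun y => ?_
    rw [Pi.mul_apply, ← ENNReal.ofReal_mul (hmd.nonneg y)]
    rcases (hmd.nonneg y).eq_or_lt with h1 | h1
    · have h2 := hle' a h0 y
      rw [← h1, mul_zero] at h2
      rw [← h1, le_antisymm h2 ((hh a).nonneg y), zero_mul]
    · rw [mul_div_cancel₀ _ h1.ne']
  have hac : jointLaw p W ≪ (jointLaw p W).fst.prod (jointLaw p W).snd := by
    conv_lhs => rw [hJ]
    exact withDensity_absolutelyContinuous _ _
  have hJprob : IsProbabilityMeasure (jointLaw p W) := by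
    constructor
    have := hfstprob.measure_univ
    rwa [Measure.fst_univ] at this
  have hrn : (jointLaw p W).rnDeriv ((jointLaw p W).fst.prod (jointLaw p W).snd) =ᵐ[
      (jointLaw p W).fst.prod (jointLaw p W).snd]
      fun z => ENNReal.ofReal (h z.1 z.2 / m z.2) := by
    have := Measure.rnDeriv_withDensity ((jointLaw p W).fst.prod (jointLaw p W).snd) hrm
    rwa [← hJ] at this
  have hkl : klDiv (jointLaw p W) ((jointLaw p W).fst.prod (jointLaw p W).snd) =
      ∑ a, p a * ENNReal.ofReal
        (∫ y, (h a y * Real.log (h a y) - h a y * Real.log (m y)) ∂ν) := by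
    rw [klDiv_eq_lintegral_klFun_of_ac hac]
    have : ∀ᵐ z ∂((jointLaw p W).fst.prod (jointLaw p W).snd),
        ENNReal.ofReal (klFun ((jointLaw p W).rnDeriv
          ((jointLaw p W).fst.prod (jointLaw p W).snd) z).toReal) =
        ENNReal.ofReal (klFun (h z.1 z.2 / m z.2)) := by
      filter_upwards [hrn] with z hz
      rw [hz, ENNReal.toReal_ofReal (div_nonneg ((hh _).nonneg _) (hmd.nonneg _))]
    rw [lintegral_congr_ae this, hlint]
    · refine Finset.sum_congr rfl fun a _ => ?_
      by_cases h0 : p a = 0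
      · simp [h0]
      rw [hsnd, (lintegral_klFun_div (hh a) hmd (inv_nonneg.2 (hpa a h0).le) (hle' a h0)).1]
    · refine measurable_from_prod_countable_right fun a => ?_
      have := (hh a).measurable
      have := hmd.measurable
      dsimp only
      fun_prop
  have hint : ∀ a, Integrable (fun y => (p a).toReal * (h a y * Real.log (m y))) ν := fun a => by
    refine hmd.integrable_mul_log.mono
      (((hh a).measurable.mul hmd.measurable.log).const_mul _).aestronglyMeasurable
      (ae_of_all _ fun y => ?_)
    rw [← mul_assoc, norm_mul _ (Real.log _), norm_mul _ (Real.log _)]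
    refine mul_le_mul_of_nonneg_right ?_ (norm_nonneg _)
    rw [Real.norm_of_nonneg (mul_nonneg ENNReal.toReal_nonneg ((hh a).nonneg y)),
      Real.norm_of_nonneg (hmd.nonneg y)]
    exact hle a y
  have hterm : ∀ a, (p a).toReal * ∫ y, (h a y * Real.log (h a y) - h a y * Real.log (m y)) ∂ν =
      (p a).toReal * densityEntropy ν (h a) -
        ∫ y, (p a).toReal * (h a y * Real.log (m y)) ∂ν := fun a => by
    rw [densityEntropy, ← integral_const_mul, ← integral_const_mul,
      ← integral_sub ((hh a).integrable_mul_log.const_mul _) (hint a)]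
    simp_rw [mul_sub]
  have hsum : ∑ a, (p a).toReal *
      ∫ y, (h a y * Real.log (h a y) - h a y * Real.log (m y)) ∂ν =
      ∑ a, (p a).toReal * densityEntropy ν (h a) - densityEntropy ν m := by
    simp_rw [hterm]
    rw [Finset.sum_sub_distrib, ← integral_finsetSum _ fun a _ => hint a, densityEntropy]
    simp_rw [← mul_assoc, ← Finset.sum_mul]
    rfl
  rw [mutualInfo, hkl, ENNReal.ofReal_div_of_pos (Real.log_pos one_lt_two), ← hsum,
    ENNReal.ofReal_sum_of_nonneg]
  · congr 1
    refine Finset.sum_congr rfl fun a _ => ?_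
    rw [ENNReal.ofReal_mul ENNReal.toReal_nonneg, ENNReal.ofReal_toReal (p.apply_ne_top a)]
  · intro a _
    by_cases h0 : p a = 0
    · simp [h0]
    · exact mul_nonneg ENNReal.toReal_nonneg
        (lintegral_klFun_div (hh a) hmd (inv_nonneg.2 (hpa a h0).le) (hle' a h0)).2

end MutualInformation

/-! ### Product densities: additivity of entropy and concentration. -/

section Product

variable {ι : Type*} [Fintype ι] {α : Type*} [MeasurableSpace α] {ν : Measure α}
  [IsProbabilityMeasure ν]

theorem IsBoundedDensity.pi {f : ι → α → ℝ} {B : ℝ} (hf : ∀ i, IsBoundedDensity ν (f i) B) :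
    IsBoundedDensity (Measure.pi fun _ : ι => ν) (fun y => ∏ i, f i (y i))
      (B ^ Fintype.card ι) where
  measurable := Finset.measurable_fun_prod _ fun i _ =>
    (hf i).measurable.comp (measurable_pi_apply i)
  nonneg y := Finset.prod_nonneg fun i _ => (hf i).nonneg _
  le_bound y := (Finset.prod_le_prod (fun i _ => (hf i).nonneg _)
    fun i _ => (hf i).le_bound _).trans_eq (by simp)
  integral_eq_one := by
    rw [integral_fintype_prod_eq_prod]
    simp [(hf _).integral_eq_one]

theorem pi_withDensity {f : ι → α → ℝ} {B : ℝ} (hf : ∀ i, IsBoundedDensity ν (f i) B) :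
    (Measure.pi fun i => ν.withDensity fun y => ENNReal.ofReal (f i y)) =
      (Measure.pi fun _ : ι => ν).withDensity fun y => ENNReal.ofReal (∏ i, f i (y i)) := by
  have := fun i => (hf i).isProbabilityMeasure
  have hP := IsBoundedDensity.pi hf
  have hPp := hP.isProbabilityMeasure
  refine (Measure.pi_eq fun s hs => ?_)
  rw [← ENNReal.toReal_eq_toReal_iff' (measure_ne_top _ _)
    (ENNReal.prod_ne_top fun i _ => measure_ne_top _ _), ENNReal.toReal_prod]
  change Measure.real _ _ = ∏ i, Measure.real _ _
  rw [hP.withDensity_real (MeasurableSet.univ_pi hs)]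
  simp_rw [(hf _).withDensity_real (hs _)]
  simp_rw [← integral_indicator (hs _)]
  rw [← integral_indicator (MeasurableSet.univ_pi hs),
    ← integral_fintype_prod_eq_prod (fun i => (s i).indicator (f i))]
  congr 1
  funext y
  by_cases hy : y ∈ Set.univ.pi s
  · rw [Set.indicator_of_mem hy]
    exact Finset.prod_congr rfl fun i _ => (Set.indicator_of_mem (hy i trivial) _).symm
  · rw [Set.indicator_of_notMem hy]
    simp only [Set.mem_pi, Set.mem_univ, true_imp_iff, not_forall] at hy
    obtain ⟨i, hi⟩ := hy
    exact (Finset.prod_eq_zero (Finset.mem_univ i) (Set.indicator_of_notMem hi _)).symm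

theorem densityEntropy_pi {f : ι → α → ℝ} {B : ℝ} (hf : ∀ i, IsBoundedDensity ν (f i) B) :
    densityEntropy (Measure.pi fun _ : ι => ν) (fun y => ∏ i, f i (y i)) =
      ∑ i, densityEntropy ν (f i) := by
  classical
  -- The logarithm of the product becomes a sum over j of products whose j-th factor alone carries a
  -- logarithm, so that Fubini applies to each term. Where the product vanishes both sides are zero.
  have hpt : ∀ y : ι → α, (∏ i, f i (y i)) * Real.log (∏ i, f i (y i)) =
      ∑ j, ∏ i, f i (y i) * (if i = j then Real.log (f i (y i)) else 1) := fun y => by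
    simp_rw [Finset.prod_mul_distrib, ← Finset.mul_sum]
    by_cases h0 : ∏ i, f i (y i) = 0
    · simp [h0]
    · rw [Real.log_prod fun i _ => (Finset.prod_ne_zero_iff.1 h0) i (Finset.mem_univ i)]
      simp
  have hint : ∀ j : ι, Integrable (fun y : ι → α => ∏ i, f i (y i) *
      (if i = j then Real.log (f i (y i)) else 1)) (Measure.pi fun _ : ι => ν) := fun j => by
    refine Integrable.fintype_prod
      (f := fun i y => f i y * (if i = j then Real.log (f i y) else 1)) fun i => ?_
    split_ifs
    · exact (hf i).integrable_mul_log
    · simpa using (hf i).integrable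
  rw [densityEntropy]
  simp_rw [hpt]
  rw [integral_finsetSum _ fun j _ => hint j]
  refine Finset.sum_congr rfl fun j _ => ?_
  rw [integral_fintype_prod_eq_prod
    (fun i y => f i y * (if i = j then Real.log (f i y) else 1)), Finset.prod_eq_single j]
  · simp [densityEntropy]
  · intro i _ hij
    simp [hij, (hf i).integral_eq_one]
  · simp

/-- Chebyshev's inequality for the log-likelihood ratio of `|ι|` independent observations. -/
theorem setIntegral_prod_lt_le {f : α → ℝ} {B : ℝ} (hf : IsBoundedDensity ν f B) :
    ∃ V : ℝ, ∀ (ι : Type) [Fintype ι] [Nonempty ι] (δ : ℝ), 0 < δ →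
      ∫ y in {y | ∏ i, f (y i) < Real.exp (Fintype.card ι * (densityEntropy ν f - δ))},
        ∏ i, f (y i) ∂(Measure.pi fun _ : ι => ν) ≤ V / (Fintype.card ι * δ ^ 2) := by
  set P : Measure α := ν.withDensity fun y => ENNReal.ofReal (f y) with hP
  have hPp : IsProbabilityMeasure P := hf.isProbabilityMeasure
  -- The second moment under P is the integral of f log² f against the reference, which is finite
  -- because f is bounded.
  have hmem : MemLp (fun y => Real.log (f y)) 2 P := by
    rw [memLp_two_iff_integrable_sq hf.measurable.log.aestronglyMeasurable, hP,
      integrable_withDensity_iff hf.measurable.ennreal_ofReal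
        (ae_of_all _ fun _ => ENNReal.ofReal_lt_top)]
    simpa only [ENNReal.toReal_ofReal (hf.nonneg _), mul_comm] using hf.integrable_mul_log_sq
  refine ⟨ProbabilityTheory.variance (fun y => Real.log (f y)) P, fun ι _ _ δ hδ => ?_⟩
  have hcard : (0 : ℝ) < Fintype.card ι := by exact_mod_cast Fintype.card_pos
  have hprod := IsBoundedDensity.pi (ι := ι) fun _ => hf
  have hpi := pi_withDensity (ι := ι) fun _ => hf
  have hS : MeasurableSet {y : ι → α | ∏ i, f (y i) <
      Real.exp (Fintype.card ι * (densityEntropy ν f - δ))} :=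
    measurableSet_lt hprod.measurable measurable_const
  rw [← hprod.withDensity_real hS, ← hpi, ← hP]
  set X : (ι → α) → ℝ := ∑ i : ι, fun y : ι → α => Real.log (f (y i)) with hX
  have hXmem : MemLp X 2 (Measure.pi fun _ : ι => P) :=
    memLp_finsetSum' _ fun i _ => hmem.comp_measurePreserving (measurePreserving_eval _ i)
  have hvar : ProbabilityTheory.variance X (Measure.pi fun _ : ι => P) =
      Fintype.card ι * ProbabilityTheory.variance (fun y => Real.log (f y)) P := by
    rw [hX, ProbabilityTheory.variance_sum_pi (X := fun _ : ι => fun y => Real.log (f y))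
      fun _ => hmem]
    simp
  have hmean : ∫ y, X y ∂(Measure.pi fun _ : ι => P) = Fintype.card ι * densityEntropy ν f := by
    have h1 : ∀ i : ι, ∫ y : ι → α, Real.log (f (y i)) ∂(Measure.pi fun _ : ι => P) =
        densityEntropy ν f := fun i => by
      rw [densityEntropy]
      have h2 := integral_map (μ := Measure.pi fun _ : ι => P)
        (measurable_pi_apply i).aemeasurable hf.measurable.log.aestronglyMeasurable
      rw [← hf.integral_withDensity, ← hP]
      exact h2.symm.trans
        (congrArg (fun μ => ∫ y, Real.log (f y) ∂μ)
          (measurePreserving_eval (fun _ : ι => P) i).map_eq)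
    simp only [hX, Finset.sum_apply]
    rw [integral_finsetSum]
    · simp [h1]
    · intro i _
      exact ((hmem.comp_measurePreserving (measurePreserving_eval (fun _ : ι => P) i))).integrable
        (by norm_num)
  -- The logarithm of the product splits into a sum only where no factor vanishes; the exceptional
  -- set is null under the law whose density is this very product.
  have hpos : ∀ᵐ y ∂(Measure.pi fun _ : ι => P), ∏ i, f (y i) ≠ 0 := by
    rw [hP, hpi, ae_withDensity_iff hprod.measurable.ennreal_ofReal]
    refine ae_of_all _ fun y hy h0 => hy ?_
    rw [h0, ENNReal.ofReal_zero]
  have hcheb := ProbabilityTheory.meas_ge_le_variance_div_sq hXmem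
    (c := Fintype.card ι * δ) (by positivity)
  have hle : (Measure.pi fun _ : ι => P) {y : ι → α | ∏ i, f (y i) <
      Real.exp (Fintype.card ι * (densityEntropy ν f - δ))} ≤
      (Measure.pi fun _ : ι => P) {y | Fintype.card ι * δ ≤
        |X y - ∫ y, X y ∂(Measure.pi fun _ : ι => P)|} := by
    refine measure_mono_ae ?_
    filter_upwards [hpos] with y hy hlt
    have hlt' : ∏ i, f (y i) < Real.exp (Fintype.card ι * (densityEntropy ν f - δ)) := hlt
    have hpos' : 0 < ∏ i, f (y i) := lt_of_le_of_ne (hprod.nonneg y) (Ne.symm hy)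
    rw [← Real.log_lt_iff_lt_exp hpos', Real.log_prod fun i _ =>
      (Finset.prod_ne_zero_iff.1 hy) i (Finset.mem_univ i)] at hlt'
    change _ ≤ |X y - _|
    rw [hmean, le_abs, hX, Finset.sum_apply]
    right
    linarith
  refine (ENNReal.toReal_mono ENNReal.ofReal_ne_top (hle.trans hcheb)).trans_eq ?_
  rw [ENNReal.toReal_ofReal (div_nonneg (ProbabilityTheory.variance_nonneg _ _) (sq_nonneg _)),
    hvar]
  field_simp

end Product

theorem measurePreserving_curry {ι κ Y : Type*} [Fintype ι] [Fintype κ] [MeasurableSpace Y]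
    (ν : Measure Y) [IsProbabilityMeasure ν] :
    MeasurePreserving (MeasurableEquiv.curry ι κ Y) (Measure.pi fun _ : ι × κ => ν)
      (Measure.pi fun _ : ι => Measure.pi fun _ : κ => ν) where
  measurable := (MeasurableEquiv.curry ι κ Y).measurable
  map_eq := by
    have := Measure.infinitePi_map_curry (ι := ι) (κ := κ) fun _ _ => ν
    simpa only [Measure.infinitePi_eq_pi] using this

/-! ### The channel relative to its uniform output law, and its capacity. -/

namespace BIOSChannel

variable {Y : Type*} [MeasurableSpace Y] (ch : BIOSChannel Y)

/-- The output law for a uniformly distributed input symbol. -/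
noncomputable def mixture : Measure Y :=
  ch.ref.withDensity fun y => 2⁻¹ * (ch.density 0 y + ch.density 1 y)

/-- The density of the law of the output symbol with respect to `mixture`. -/
noncomputable def relDensity (x : ZMod 2) (y : Y) : ℝ :=
  -- The default value 1 makes the two densities sum to 2 at every point, not merely almost
  -- everywhere.
  if (ch.density 0 y).toReal + (ch.density 1 y).toReal = 0 then 1
  else 2 * (ch.density x y).toReal / ((ch.density 0 y).toReal + (ch.density 1 y).toReal)

theorem measurable_relDensity (x : ZMod 2) : Measurable (ch.relDensity x) := by
  have h := fun x => (ch.measurable_density x).ennreal_toReal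
  exact Measurable.ite (measurableSet_eq_fun ((h 0).add (h 1)) measurable_const)
    measurable_const (((h x).const_mul 2).div ((h 0).add (h 1)))

theorem relDensity_nonneg (x : ZMod 2) (y : Y) : 0 ≤ ch.relDensity x y := by
  unfold relDensity
  split_ifs <;> positivity

theorem relDensity_zero_add_one (y : Y) : ch.relDensity 0 y + ch.relDensity 1 y = 2 := by
  unfold relDensity
  split_ifs with h
  · norm_num
  · rw [← add_div, ← mul_add, mul_div_cancel_right₀ _ h]

theorem sum_relDensity (y : Y) : ∑ a, ch.relDensity a y = 2 :=
  (Fin.sum_univ_two fun a : Fin 2 => ch.relDensity a y).trans (ch.relDensity_zero_add_one y)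

theorem relDensity_le_two (x : ZMod 2) (y : Y) : ch.relDensity x y ≤ 2 := by
  have h0 := ch.relDensity_nonneg 0 y
  have h1 := ch.relDensity_nonneg 1 y
  have h := ch.relDensity_zero_add_one y
  fin_cases x
  · change ch.relDensity 0 y ≤ 2
    linarith
  · change ch.relDensity 1 y ≤ 2
    linarith

theorem density_flip (x : ZMod 2) (y : Y) : ch.density x (ch.flip y) = ch.density (x + 1) y := by
  fin_cases x
  · exact (ch.symmetry y).symm
  · change ch.density 1 _ = ch.density 0 y
    rw [ch.symmetry, ch.flip_flip]

theorem relDensity_flip (x : ZMod 2) (y : Y) :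
    ch.relDensity x (ch.flip y) = ch.relDensity (x + 1) y := by
  simp only [relDensity, ch.density_flip]
  rw [zero_add, show (1 + 1 : ZMod 2) = 0 from rfl, add_comm]

theorem isProbabilityMeasure_law (x : ZMod 2) : IsProbabilityMeasure (ch.law x) :=
  ⟨by rw [law, withDensity_apply _ MeasurableSet.univ, Measure.restrict_univ,
    ch.lintegral_density]⟩

instance : IsProbabilityMeasure ch.mixture := ⟨by
  rw [mixture, withDensity_apply _ MeasurableSet.univ, Measure.restrict_univ,
    lintegral_const_mul _ ((ch.measurable_density 0).fun_add (ch.measurable_density 1)),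
    lintegral_add_left (ch.measurable_density 0), ch.lintegral_density, ch.lintegral_density,
    one_add_one_eq_two, ENNReal.inv_mul_cancel two_ne_zero ENNReal.ofNat_ne_top]⟩

theorem law_eq (x : ZMod 2) :
    ch.law x = ch.mixture.withDensity fun y => ENNReal.ofReal (ch.relDensity x y) := by
  rw [law, mixture, ← withDensity_mul _ (((ch.measurable_density 0).fun_add
    (ch.measurable_density 1)).const_mul _) (ch.measurable_relDensity x).ennreal_ofReal]
  refine withDensity_congr_ae ?_
  -- Each density has integral 1, hence is finite almost everywhere, and `toReal` loses nothing
  -- there.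
  have hfin := fun x => ae_lt_top (ch.measurable_density x)
    (by rw [ch.lintegral_density]; exact ENNReal.one_ne_top)
  filter_upwards [hfin 0, hfin 1, hfin x] with y h0 h1 hx
  have key : (ch.density x y).toReal = 2⁻¹ *
      ((ch.density 0 y).toReal + (ch.density 1 y).toReal) * ch.relDensity x y := by
    have n0 : 0 ≤ (ch.density 0 y).toReal := ENNReal.toReal_nonneg
    have n1 : 0 ≤ (ch.density 1 y).toReal := ENNReal.toReal_nonneg
    unfold relDensity
    split_ifs with h
    · rw [h, mul_zero, zero_mul]
      fin_cases x
      · change (ch.density 0 y).toReal = 0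
        linarith
      · change (ch.density 1 y).toReal = 0
        linarith
    · field_simp
  rw [← ENNReal.ofReal_toReal hx.ne, key, ENNReal.ofReal_mul (by positivity),
    ENNReal.ofReal_mul (by positivity),
    ENNReal.ofReal_add ENNReal.toReal_nonneg ENNReal.toReal_nonneg,
    ENNReal.ofReal_toReal h0.ne, ENNReal.ofReal_toReal h1.ne, ENNReal.ofReal_inv_of_pos two_pos,
    ENNReal.ofReal_ofNat]
  rfl

theorem isBoundedDensity_relDensity (x : ZMod 2) :
    IsBoundedDensity ch.mixture (ch.relDensity x) 2 where
  measurable := ch.measurable_relDensity x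
  nonneg := ch.relDensity_nonneg x
  le_bound := ch.relDensity_le_two x
  integral_eq_one := by
    have h := (ch.isProbabilityMeasure_law x).measure_univ
    rw [law_eq, withDensity_apply _ MeasurableSet.univ, Measure.restrict_univ] at h
    rw [integral_eq_lintegral_of_nonneg_ae (ae_of_all _ (ch.relDensity_nonneg x))
      (ch.measurable_relDensity x).aestronglyMeasurable, h, ENNReal.toReal_one]

theorem measurePreserving_flip_mixture : MeasurePreserving ch.flip ch.mixture ch.mixture where
  measurable := ch.measurePreserving_flip.measurable
  map_eq := by
    ext s hs
    have hm : Measurable fun y => 2⁻¹ * (ch.density 0 y + ch.density 1 y) :=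
      ((ch.measurable_density 0).add (ch.measurable_density 1)).const_mul _
    rw [Measure.map_apply ch.measurePreserving_flip.measurable hs, mixture,
      withDensity_apply _ hs, withDensity_apply _ (ch.measurePreserving_flip.measurable hs),
      ← ch.measurePreserving_flip.setLIntegral_comp_preimage hs hm]
    simp only [ch.density_flip]
    rw [zero_add, show (1 + 1 : ZMod 2) = 0 from rfl]
    simp_rw [add_comm (ch.density 1 _)]

theorem densityEntropy_relDensity (x : ZMod 2) :
    densityEntropy ch.mixture (ch.relDensity x) =
      densityEntropy ch.mixture (ch.relDensity 0) := by
  have := densityEntropy_comp ch.measurePreserving_flip_mixture (ch.measurable_relDensity 0)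
  simp only [ch.relDensity_flip] at this
  fin_cases x
  · rfl
  · exact this

/-- By symmetry the mean conditional divergence is the same for every input law. What is subtracted
is the divergence of the output law from `mixture`, which is nonnegative and vanishes for the
uniform input. -/
theorem capacity_eq :
    ch.capacity = ENNReal.ofReal
      (densityEntropy ch.mixture (ch.relDensity 0) / Real.log 2) := by
  have hMI := fun p : PMF (ZMod 2) =>
    mutualInfo_jointLaw p ch.isBoundedDensity_relDensity ch.law_eq
  have hE : ∀ p : PMF (ZMod 2), ∑ a, (p a).toReal * densityEntropy ch.mixture (ch.relDensity a) =
      densityEntropy ch.mixture (ch.relDensity 0) := fun p => by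
    simp_rw [ch.densityEntropy_relDensity]
    rw [← Finset.sum_mul, sum_toReal_pmf, one_mul]
  refine le_antisymm (iSup_le fun p => ?_) ?_
  · rw [hMI, hE]
    refine ENNReal.ofReal_le_ofReal
      (div_le_div_of_nonneg_right ?_ (Real.log_pos one_lt_two).le)
    exact sub_le_self _ (IsBoundedDensity.sum ch.isBoundedDensity_relDensity
      (fun _ => ENNReal.toReal_nonneg) (sum_toReal_pmf p)).densityEntropy_nonneg
  · refine le_iSup_of_le (PMF.uniformOfFintype (ZMod 2)) ?_
    rw [hMI, hE]
    have : (fun y => ∑ a, ((PMF.uniformOfFintype (ZMod 2)) a).toReal * ch.relDensity a y) =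
        fun _ => 1 := by
      funext y
      simp only [PMF.uniformOfFintype_apply]
      rw [← Finset.mul_sum, ch.sum_relDensity]
      simp [ZMod.card]
    rw [this]
    simp [densityEntropy]

/-! ### Output sequences and the symmetry that translates the input. -/

section Sequences

variable {ι : Type*} [Fintype ι]

/-- The density of the law of the output sequence with respect to the product of `mixture`. -/
noncomputable def seqDensity (x : ι → ZMod 2) (y : ι → Y) : ℝ :=
  ∏ i, ch.relDensity (x i) (y i)

theorem isBoundedDensity_seqDensity (x : ι → ZMod 2) :
    IsBoundedDensity (Measure.pi fun _ : ι => ch.mixture) (ch.seqDensity x)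
      (2 ^ Fintype.card ι) :=
  IsBoundedDensity.pi fun i => ch.isBoundedDensity_relDensity (x i)

theorem seqLaw_eq (x : ι → ZMod 2) :
    ch.seqLaw x = (Measure.pi fun _ : ι => ch.mixture).withDensity
      fun y => ENNReal.ofReal (ch.seqDensity x y) := by
  simp_rw [seqLaw, law_eq]
  exact pi_withDensity fun i => ch.isBoundedDensity_relDensity (x i)

theorem densityEntropy_seqDensity (x : ι → ZMod 2) :
    densityEntropy (Measure.pi fun _ : ι => ch.mixture) (ch.seqDensity x) =
      Fintype.card ι * densityEntropy ch.mixture (ch.relDensity 0) := by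
  refine (densityEntropy_pi fun i => ch.isBoundedDensity_relDensity (x i)).trans ?_
  simp [ch.densityEntropy_relDensity]

/-- Expanding the product of the one-letter sums: a uniformly random word produces exactly the
reference law. -/
theorem sum_seqDensity [DecidableEq ι] (y : ι → Y) :
    ∑ x : ι → ZMod 2, ch.seqDensity x y = 2 ^ Fintype.card ι := by
  have := Finset.prod_univ_sum (fun _ : ι => (Finset.univ : Finset (ZMod 2)))
    fun i a => ch.relDensity a (y i)
  rw [Fintype.piFinset_univ] at this
  exact this.symm.trans (by simp [ch.sum_relDensity])

/-- The symmetry of the output sequences which corresponds to adding `w` to the input. -/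
noncomputable def flipSeq (w : ι → ZMod 2) (y : ι → Y) : ι → Y :=
  fun i => if w i = 0 then y i else ch.flip (y i)

theorem measurePreserving_flipSeq (w : ι → ZMod 2) :
    MeasurePreserving (ch.flipSeq w) (Measure.pi fun _ : ι => ch.mixture)
      (Measure.pi fun _ : ι => ch.mixture) := by
  refine measurePreserving_pi (f := fun i y => if w i = 0 then y else ch.flip y) _ _ fun i => ?_
  split_ifs
  · exact MeasurePreserving.id _
  · exact ch.measurePreserving_flip_mixture

theorem seqDensity_flipSeq (x w : ι → ZMod 2) (y : ι → Y) :
    ch.seqDensity x (ch.flipSeq w y) = ch.seqDensity (x + w) y := by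
  refine Finset.prod_congr rfl fun i _ => ?_
  have h01 : ∀ a : ZMod 2, a ≠ 0 → a = 1 := by decide
  by_cases h : w i = 0
  · simp [flipSeq, h]
  · simp [flipSeq, h01 _ h, relDensity_flip]

end Sequences

/-! ### The payload as noise: the channel seen by the extra bits. -/

section Payload

variable {n k : ℕ} {C₀ : Submodule (ZMod 2) (Fin n → ZMod 2)} (enc : (Fin k → ZMod 2) ≃ C₀)

theorem sum_const_inv_card {U : Type*} [Fintype U] [Nonempty U] :
    ∑ _u : U, (Fintype.card U : ℝ)⁻¹ = 1 := by
  simp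

/-- The density of the output of a random payload codeword. -/
noncomputable def payloadDensity (y : Fin n → Y) : ℝ :=
  ∑ u : Fin k → ZMod 2, (Fintype.card (Fin k → ZMod 2) : ℝ)⁻¹ *
    ch.seqDensity (enc u : Fin n → ZMod 2) y

theorem isBoundedDensity_payloadDensity :
    IsBoundedDensity (Measure.pi fun _ : Fin n => ch.mixture) (ch.payloadDensity enc) (2 ^ n) := by
  have := IsBoundedDensity.sum
    (fun u : Fin k → ZMod 2 => ch.isBoundedDensity_seqDensity (enc u : Fin n → ZMod 2))
    (fun _ => by positivity) sum_const_inv_card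
  rwa [Fintype.card_fin] at this

theorem sum_toReal_map {U A : Type*} [Fintype U] [Fintype A] (p : PMF U) (f : U → A)
    (a : A → ℝ) : ∑ x, ((p.map f) x).toReal * a x = ∑ u, (p u).toReal * a (f u) := by
  classical
  have : ∀ x, ((p.map f) x).toReal = ∑ u, if x = f u then (p u).toReal else 0 := fun x => by
    rw [PMF.map_apply, tsum_fintype, ENNReal.toReal_sum]
    · refine Finset.sum_congr rfl fun u _ => ?_
      split_ifs <;> simp
    · intro u _
      split_ifs
      · exact p.apply_ne_top u
      · exact ENNReal.zero_ne_top
  simp_rw [this, Finset.sum_mul]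
  rw [Finset.sum_comm]
  refine Finset.sum_congr rfl fun u _ => ?_
  simp [ite_mul]

theorem payloadInfo_eq :
    ch.payloadInfo enc = ENNReal.ofReal ((n * densityEntropy ch.mixture (ch.relDensity 0) -
      densityEntropy (Measure.pi fun _ : Fin n => ch.mixture) (ch.payloadDensity enc)) /
        Real.log 2) := by
  rw [payloadInfo, mutualInfo_jointLaw _ ch.isBoundedDensity_seqDensity ch.seqLaw_eq]
  simp_rw [sum_toReal_map, ch.densityEntropy_seqDensity]
  have hu : ∀ u : Fin k → ZMod 2, ((PMF.uniformOfFintype (Fin k → ZMod 2)) u).toReal =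
      (Fintype.card (Fin k → ZMod 2) : ℝ)⁻¹ := fun u => by
    simp [PMF.uniformOfFintype_apply]
  simp_rw [hu]
  rw [← Finset.sum_mul, sum_const_inv_card, one_mul, Fintype.card_fin]
  rfl

theorem densityEntropy_payloadDensity_le :
    densityEntropy (Measure.pi fun _ : Fin n => ch.mixture) (ch.payloadDensity enc) ≤
      n * densityEntropy ch.mixture (ch.relDensity 0) := by
  refine (densityEntropy_sum_le
    (fun u : Fin k → ZMod 2 => ch.isBoundedDensity_seqDensity (enc u : Fin n → ZMod 2))
    (fun _ => by positivity) sum_const_inv_card).trans_eq ?_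
  simp_rw [ch.densityEntropy_seqDensity]
  rw [← Finset.sum_mul, sum_const_inv_card, one_mul, Fintype.card_fin]

/-- The contribution of the channel noise cancels, leaving the divergence of the payload output from
the uniform output law. The nonnegativity of both quantities is what lets `toReal` undo `ofReal`. -/
theorem capacity_sub_payloadInfo (hn : 0 < n) :
    ch.capacity.toReal - (ch.payloadInfo enc).toReal / n =
      densityEntropy (Measure.pi fun _ : Fin n => ch.mixture) (ch.payloadDensity enc) /
        (n * Real.log 2) := by
  have hlog := Real.log_pos one_lt_two
  rw [capacity_eq, payloadInfo_eq, ENNReal.toReal_ofReal (div_nonneg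
      (ch.isBoundedDensity_relDensity 0).densityEntropy_nonneg hlog.le),
    ENNReal.toReal_ofReal (div_nonneg
      (sub_nonneg.2 (ch.densityEntropy_payloadDensity_le enc)) hlog.le)]
  field_simp
  ring

/-- The density of the output sequence when `w` is added to random payload codewords. -/
noncomputable def blockDensity {L : ℕ} (w : Fin L × Fin n → ZMod 2) (y : Fin L × Fin n → Y) : ℝ :=
  ∑ u : Fin L → Fin k → ZMod 2, (Fintype.card (Fin L → Fin k → ZMod 2) : ℝ)⁻¹ *
    ch.seqDensity (payloadCodeword enc u + w) y

variable {L : ℕ}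

theorem isBoundedDensity_blockDensity (w : Fin L × Fin n → ZMod 2) :
    IsBoundedDensity (Measure.pi fun _ : Fin L × Fin n => ch.mixture) (ch.blockDensity enc w)
      (2 ^ Fintype.card (Fin L × Fin n)) :=
  IsBoundedDensity.sum
    (fun u : Fin L → Fin k → ZMod 2 => ch.isBoundedDensity_seqDensity (payloadCodeword enc u + w))
    (fun _ => by positivity) sum_const_inv_card

theorem blockDensity_flipSeq (x w : Fin L × Fin n → ZMod 2) (y : Fin L × Fin n → Y) :
    ch.blockDensity enc x (ch.flipSeq w y) = ch.blockDensity enc (x + w) y := by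
  simp only [blockDensity, seqDensity_flipSeq, add_assoc]

theorem sum_blockDensity (y : Fin L × Fin n → Y) :
    ∑ w : Fin L × Fin n → ZMod 2, ch.blockDensity enc w y = 2 ^ (L * n) := by
  simp only [blockDensity]
  rw [Finset.sum_comm]
  simp_rw [← Finset.mul_sum]
  have : ∀ c : Fin L × Fin n → ZMod 2,
      ∑ w : Fin L × Fin n → ZMod 2, ch.seqDensity (c + w) y = 2 ^ (L * n) := fun c => by
    refine (Fintype.sum_equiv (Equiv.addLeft c) _ (fun w => ch.seqDensity w y)
      fun w => rfl).trans ?_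
    rw [sum_seqDensity]
    simp
  simp_rw [this]
  rw [Finset.mul_sum, ← Finset.sum_mul, sum_const_inv_card, one_mul]

/-- The blocks of payload are independent, so the average over all data sequences factors by
distributivity. -/
theorem blockDensity_zero (y : Fin L × Fin n → Y) :
    ch.blockDensity enc 0 y = ∏ t, ch.payloadDensity enc (MeasurableEquiv.curry _ _ _ y t) := by
  simp only [blockDensity, payloadDensity, ← Finset.mul_sum, Finset.prod_mul_distrib]
  have := Finset.prod_univ_sum
    (fun _ : Fin L => (Finset.univ : Finset (Fin k → ZMod 2)))
    fun t u => ch.seqDensity (enc u : Fin n → ZMod 2) (MeasurableEquiv.curry _ _ _ y t)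
  rw [Fintype.piFinset_univ] at this
  rw [this, Finset.prod_const]
  congr 1
  · simp
  · refine Finset.sum_congr rfl fun u _ => ?_
    simp only [seqDensity, Fintype.prod_prod_type, add_zero]
    rfl

/-- A measure-preserving flip reduces to w = 0, where currying turns the density into a product of L
equal factors. -/
theorem densityEntropy_blockDensity (w : Fin L × Fin n → ZMod 2) :
    densityEntropy (Measure.pi fun _ : Fin L × Fin n => ch.mixture) (ch.blockDensity enc w) =
      L * densityEntropy (Measure.pi fun _ : Fin n => ch.mixture) (ch.payloadDensity enc) := by
  have h1 := densityEntropy_comp (ch.measurePreserving_flipSeq w)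
    (ch.isBoundedDensity_blockDensity enc 0).measurable
  simp only [blockDensity_flipSeq, zero_add] at h1
  have h2 := densityEntropy_pi (ι := Fin L) fun _ => ch.isBoundedDensity_payloadDensity enc
  have h3 := (measurePreserving_curry (ι := Fin L) (κ := Fin n) ch.mixture).integral_comp'
    fun y : Fin L → Fin n → Y => (∏ t, ch.payloadDensity enc (y t)) *
      Real.log (∏ t, ch.payloadDensity enc (y t))
  simp_rw [← blockDensity_zero] at h3
  exact h1.trans (h3.trans (h2.trans (by simp)))

/-- Flipping the outputs translates all inputs at once, so the whole family of densities may be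
shifted under the integral. This lets pairwise error terms depend only on the difference of two
words. -/
theorem integral_blockDensity_comp (w : Fin L × Fin n → ZMod 2)
    {φ : ((Fin L × Fin n → ZMod 2) → ℝ) → ℝ} (hφ : Measurable φ) :
    ∫ y, φ (fun x => ch.blockDensity enc (x + w) y)
        ∂(Measure.pi fun _ : Fin L × Fin n => ch.mixture) =
      ∫ y, φ (fun x => ch.blockDensity enc x y)
        ∂(Measure.pi fun _ : Fin L × Fin n => ch.mixture) := by
  have hm : Measurable fun y => φ (fun x => ch.blockDensity enc x y) :=
    hφ.comp (measurable_pi_iff.2 fun x => (ch.isBoundedDensity_blockDensity enc x).measurable)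
  have := integral_map (ch.measurePreserving_flipSeq w).measurable.aemeasurable
    (μ := Measure.pi fun _ : Fin L × Fin n => ch.mixture) hm.aestronglyMeasurable
  rw [(ch.measurePreserving_flipSeq w).map_eq] at this
  simp only [blockDensity_flipSeq] at this
  exact this.symm

/-- Chebyshev's bound for the product at w = 0, transported to every w by the flip symmetry; hence V
depends neither on L nor on w. -/
theorem setIntegral_blockDensity_lt_le :
    ∃ V : ℝ, ∀ (L : ℕ), 0 < L → ∀ (δ : ℝ), 0 < δ → ∀ w : Fin L × Fin n → ZMod 2,
      ∫ y in {y | ch.blockDensity enc w y < Real.exp (L * (densityEntropy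
          (Measure.pi fun _ : Fin n => ch.mixture) (ch.payloadDensity enc) - δ))},
        ch.blockDensity enc w y ∂(Measure.pi fun _ : Fin L × Fin n => ch.mixture) ≤
          V / (L * δ ^ 2) := by
  obtain ⟨V, hV⟩ := setIntegral_prod_lt_le (ch.isBoundedDensity_payloadDensity enc)
  refine ⟨V, fun L hL δ hδ w => ?_⟩
  have := Fin.pos_iff_nonempty.1 hL
  have h1 := hV (Fin L) δ hδ
  rw [Fintype.card_fin, ← (measurePreserving_curry (ι := Fin L) (κ := Fin n)
    ch.mixture).setIntegral_preimage_emb (MeasurableEquiv.measurableEmbedding _)] at h1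
  simp only [Set.preimage_ofPred_eq, ← blockDensity_zero] at h1
  refine le_trans (le_of_eq ?_) h1
  set T := Real.exp (L * (densityEntropy
          (Measure.pi fun _ : Fin n => ch.mixture) (ch.payloadDensity enc) - δ))
  have hmeas := fun w : Fin L × Fin n → ZMod 2 =>
    (ch.isBoundedDensity_blockDensity enc w).measurable
  rw [← integral_indicator (measurableSet_lt (hmeas _) measurable_const),
    ← integral_indicator (measurableSet_lt (hmeas _) measurable_const)]
  have := ch.integral_blockDensity_comp enc w
    (φ := fun F => (Set.Iio T).indicator id (F 0))
    ((measurable_id.indicator measurableSet_Iio).comp (measurable_pi_apply _))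
  simp only [zero_add] at this
  exact this

end Payload

end BIOSChannel

/-! ### A Fano-type bound. -/

theorem IsBoundedDensity.integrable_mul {α : Type*} [MeasurableSpace α] {ν : Measure α}
    [IsFiniteMeasure ν] {f g : α → ℝ} {B B' : ℝ} (hf : IsBoundedDensity ν f B)
    (hg : IsBoundedDensity ν g B') : Integrable (fun y => f y * g y) ν :=
  hf.integrable.mul_bdd (c := B') hg.measurable.aestronglyMeasurable
    (ae_of_all _ fun y => by rw [Real.norm_of_nonneg (hg.nonneg y)]; exact hg.le_bound y)

/-- A form of Fano's inequality: `|V|` disjoint decision regions for the densities `h v`. -/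
theorem log_card_mul_sum_setIntegral_le {V α : Type*} [Fintype V] [Nonempty V]
    [MeasurableSpace α] {ν : Measure α} [IsProbabilityMeasure ν] {h : V → α → ℝ} {B : ℝ}
    (hh : ∀ v, IsBoundedDensity ν (h v) B) {A : V → Set α} (hA : ∀ v, MeasurableSet (A v))
    (hdisj : Pairwise fun v w => Disjoint (A v) (A w)) :
    Real.log (Fintype.card V) * ∑ v, ∫ y in A v, h v y ∂ν ≤
      ∑ v, densityEntropy ν (h v) + Fintype.card V := by
  set M : ℝ := (Fintype.card V : ℝ)
  have hMpos : 0 < M := Nat.cast_pos.2 Fintype.card_pos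
  have key : ∀ v, Real.log M * ∫ y in A v, h v y ∂ν ≤
      densityEntropy ν (h v) + M * ν.real (A v) := fun v => by
    have hi1 : Integrable (fun y => Real.log M * (A v).indicator (h v) y) ν :=
      ((hh v).integrable.indicator (hA v)).const_mul _
    have hi2 : Integrable (fun y => (A v).indicator (fun _ => M) y) ν :=
      (integrable_const M).indicator (hA v)
    have hi3 : Integrable (fun y => h v y - 1) ν := (hh v).integrable.sub (integrable_const 1)
    have hi4 : Integrable (fun y => Real.log M * (A v).indicator (h v) y -
        (A v).indicator (fun _ => M) y) ν := hi1.sub hi2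
    -- Young's inequality is applied with s = log M on the decision region and with s = 0 off it.
    have hle : ∫ y, (Real.log M * (A v).indicator (h v) y - (A v).indicator (fun _ => M) y +
        (h v y - 1)) ∂ν ≤ densityEntropy ν (h v) :=
      integral_mono (hi4.add hi3) (hh v).integrable_mul_log fun y => by
        by_cases hy : y ∈ A v
        · have := mul_log_ge (h v y) (Real.log M) ((hh v).nonneg y)
          rw [Real.exp_log hMpos] at this
          simp only [Set.indicator_of_mem hy]
          linarith
        · have := mul_log_ge (h v y) 0 ((hh v).nonneg y)
          rw [Real.exp_zero] at this
          simp only [Set.indicator_of_notMem hy]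
          linarith
    rw [integral_add hi4 hi3, integral_sub hi1 hi2,
      integral_sub (hh v).integrable (integrable_const 1), (hh v).integral_eq_one,
      integral_const_mul, integral_indicator (hA v), integral_indicator (hA v),
      setIntegral_const] at hle
    simp only [integral_const, probReal_univ, smul_eq_mul] at hle
    linarith
  have hsum : ∑ v, ν.real (A v) ≤ 1 := by
    have := measureReal_biUnion_finset (μ := ν) (s := Finset.univ) (f := A)
      (fun v _ w _ hvw => hdisj hvw) (fun v _ => hA v)
    rw [← this]
    exact measureReal_le_one
  calc Real.log M * ∑ v, ∫ y in A v, h v y ∂ν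
      = ∑ v, Real.log M * ∫ y in A v, h v y ∂ν := Finset.mul_sum _ _ _
    _ ≤ ∑ v, (densityEntropy ν (h v) + M * ν.real (A v)) := Finset.sum_le_sum fun v _ => key v
    _ = ∑ v, densityEntropy ν (h v) + M * ∑ v, ν.real (A v) := by
      rw [Finset.sum_add_distrib, Finset.mul_sum]
    _ ≤ _ := by nlinarith

/-! ### Random linear maps. -/

section RandomLinear

variable {κ W : Type*} [Fintype κ] [Fintype W] [AddCommGroup W] [Module (ZMod 2) W]

/-- The image of a nonzero vector under a random linear map is uniformly distributed. -/
theorem card_mul_sum_linearCombination [DecidableEq κ] {v : κ → ZMod 2} (hv : v ≠ 0) (φ : W → ℝ) :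
    Fintype.card W * ∑ g : κ → W, φ (Fintype.linearCombination (ZMod 2) g v) =
      Fintype.card (κ → W) * ∑ w, φ w := by
  obtain ⟨i, hi⟩ := Function.ne_iff.1 hv
  have h01 : ∀ a : ZMod 2, a ≠ 0 → a = 1 := by decide
  have hi1 : v i = 1 := h01 _ hi
  -- Adding a to the i-th generator permutes the maps and moves the image of v by a, since the i-th
  -- coordinate of v is 1. Averaging over a then makes the image uniform.
  have hshift : ∀ a : W, ∑ g : κ → W, φ (Fintype.linearCombination (ZMod 2) g v) =
      ∑ g : κ → W, φ (Fintype.linearCombination (ZMod 2) g v + a) := fun a => by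
    refine (Fintype.sum_equiv (Equiv.addRight (Pi.single i a)) _ _ fun g => ?_).symm
    congr 1
    simp only [Fintype.linearCombination_apply, Equiv.coe_addRight, Pi.add_apply, smul_add,
      Finset.sum_add_distrib]
    congr 1
    rw [Finset.sum_eq_single i]
    · simp [hi1]
    · intro j _ hj
      simp [hj]
    · simp
  calc (Fintype.card W : ℝ) * ∑ g : κ → W, φ (Fintype.linearCombination (ZMod 2) g v)
      = ∑ _a : W, ∑ g : κ → W, φ (Fintype.linearCombination (ZMod 2) g v) := by simp
    _ = ∑ a : W, ∑ g : κ → W, φ (Fintype.linearCombination (ZMod 2) g v + a) :=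
      Finset.sum_congr rfl fun a _ => hshift a
    _ = ∑ g : κ → W, ∑ a : W, φ (Fintype.linearCombination (ZMod 2) g v + a) := Finset.sum_comm
    _ = ∑ g : κ → W, ∑ w, φ w := Finset.sum_congr rfl fun g _ =>
      Fintype.sum_equiv (Equiv.addLeft (Fintype.linearCombination (ZMod 2) g v)) _ _ fun _ => rfl
    _ = _ := by simp

end RandomLinear

/-! ### Error rates: the converse bound and random linear coding. -/

namespace FreeRideCode

variable {n L k₁ k : ℕ} {Y : Type*} [MeasurableSpace Y] (ch : BIOSChannel Y)
  {C₀ : Submodule (ZMod 2) (Fin n → ZMod 2)} (enc : (Fin k → ZMod 2) ≃ C₀)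

theorem errorRate_eq (S : FreeRideCode n L k₁ Y) :
    S.errorRate ch enc = (∑ v, ∫ y in {y | S.decode y ≠ v}, ch.blockDensity enc (S.encode v) y
      ∂(Measure.pi fun _ : Fin L × Fin n => ch.mixture)) / 2 ^ k₁ := by
  have h : ∀ v, ∑ u : Fin L → Fin k → ZMod 2,
      (ch.seqLaw (payloadCodeword enc u + S.encode v)).real {y | S.decode y ≠ v} =
      2 ^ (k * L) * ∫ y in {y | S.decode y ≠ v}, ch.blockDensity enc (S.encode v) y
      ∂(Measure.pi fun _ : Fin L × Fin n => ch.mixture) := fun v => by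
    have hm : MeasurableSet {y | S.decode y ≠ v} := (S.measurableSet_decode v).compl
    simp_rw [ch.seqLaw_eq, (ch.isBoundedDensity_seqDensity _).withDensity_real hm,
      BIOSChannel.blockDensity]
    rw [integral_finsetSum _ fun u _ =>
      ((ch.isBoundedDensity_seqDensity _).integrable.const_mul _).integrableOn]
    simp_rw [integral_const_mul]
    rw [← Finset.mul_sum, ← mul_assoc]
    have : (2 : ℝ) ^ (k * L) * (Fintype.card (Fin L → Fin k → ZMod 2) : ℝ)⁻¹ = 1 := by
      simp [pow_mul]
    rw [this, one_mul]
  rw [errorRate, Finset.sum_comm]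
  simp_rw [h]
  rw [← Finset.mul_sum, mul_div_mul_left _ _ (by positivity)]

theorem errorRate_nonneg (S : FreeRideCode n L k₁ Y) : 0 ≤ S.errorRate ch enc :=
  div_nonneg (Finset.sum_nonneg fun _ _ => Finset.sum_nonneg fun _ _ => measureReal_nonneg)
    (by positivity)

theorem sum_setIntegral_decode (S : FreeRideCode n L k₁ Y) :
    ∑ v, ∫ y in {y | S.decode y = v}, ch.blockDensity enc (S.encode v) y
      ∂(Measure.pi fun _ : Fin L × Fin n => ch.mixture) =
      2 ^ k₁ * (1 - S.errorRate ch enc) := by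
  have h : ∀ v, ∫ y in {y | S.decode y = v}, ch.blockDensity enc (S.encode v) y
      ∂(Measure.pi fun _ : Fin L × Fin n => ch.mixture) =
      1 - ∫ y in {y | S.decode y ≠ v}, ch.blockDensity enc (S.encode v) y
      ∂(Measure.pi fun _ : Fin L × Fin n => ch.mixture) := fun v => by
    have hF := ch.isBoundedDensity_blockDensity enc (S.encode v)
    have := integral_add_compl (S.measurableSet_decode v) hF.integrable
    rw [hF.integral_eq_one] at this
    exact eq_sub_of_add_eq this
  simp_rw [h]
  rw [Finset.sum_sub_distrib, errorRate_eq, mul_sub, mul_div_cancel₀ _ (by positivity)]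
  simp

/-- The converse for finite L: the Fano-type bound for the decision regions of the decoder, divided
by the number of messages. Every word has the same divergence, so the encoder plays no role. -/
theorem log_two_mul_le (S : FreeRideCode n L k₁ Y) :
    k₁ * Real.log 2 * (1 - S.errorRate ch enc) ≤
      L * densityEntropy (Measure.pi fun _ : Fin n => ch.mixture) (ch.payloadDensity enc) + 1 := by
  have h := log_card_mul_sum_setIntegral_le
    (fun v => ch.isBoundedDensity_blockDensity enc (S.encode v)) S.measurableSet_decode
    fun v w hvw => Set.disjoint_left.2 fun y hv hw => hvw (hv.symm.trans hw)
  rw [sum_setIntegral_decode] at h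
  simp_rw [ch.densityEntropy_blockDensity] at h
  have hc : (Fintype.card (Fin k₁ → ZMod 2) : ℝ) = 2 ^ k₁ := by simp
  rw [Finset.sum_const, Finset.card_univ, nsmul_eq_mul, hc, Real.log_pow] at h
  have hpos : (0 : ℝ) < 2 ^ k₁ := by positivity
  refine le_of_mul_le_mul_left ?_ hpos
  linarith

theorem one_sub_errorRate_nonneg (S : FreeRideCode n L k₁ Y) : 0 ≤ 1 - S.errorRate ch enc := by
  have h := sum_setIntegral_decode ch enc S
  have h0 : 0 ≤ (2 : ℝ) ^ k₁ * (1 - S.errorRate ch enc) := by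
    rw [← h]
    exact Finset.sum_nonneg fun v _ =>
      integral_nonneg (ch.isBoundedDensity_blockDensity enc (S.encode v)).nonneg
  exact nonneg_of_mul_nonneg_right h0 (by positivity)

open Classical in
/-- The linear code `E` with the decoder which looks for a message whose likelihood ratio reaches
the threshold `T`. -/
noncomputable def thresholdCode (E : (Fin k₁ → ZMod 2) →ₗ[ZMod 2] (Fin L × Fin n → ZMod 2))
    (T : ℝ) : FreeRideCode n L k₁ Y where
  encode := E
  decode y := if h : ∃ v, T ≤ ch.blockDensity enc (E v) y then h.choose else 0
  measurableSet_decode v := by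
    -- The decoder sees y only through the set of messages that pass the threshold; this set ranges
    -- over a finite discrete space, so the arbitrary choice made there does no harm.
    have hm : Measurable fun (y : Fin L × Fin n → Y) (v : Fin k₁ → ZMod 2) =>
        T ≤ ch.blockDensity enc (E v) y :=
      measurable_pi_iff.2 fun v => measurableSet_setOfPred.1
        (measurableSet_le measurable_const (ch.isBoundedDensity_blockDensity enc (E v)).measurable)
    exact hm (MeasurableSet.of_discrete
      (s := {s : (Fin k₁ → ZMod 2) → Prop | (if h : ∃ v, s v then h.choose else 0) = v}))

theorem integral_blockDensity_mul (a b : Fin L × Fin n → ZMod 2) :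
    ∫ y, ch.blockDensity enc a y * ch.blockDensity enc b y
      ∂(Measure.pi fun _ : Fin L × Fin n => ch.mixture) =
    ∫ y, ch.blockDensity enc 0 y * ch.blockDensity enc (b - a) y
      ∂(Measure.pi fun _ : Fin L × Fin n => ch.mixture) := by
  have := ch.integral_blockDensity_comp enc a (φ := fun F => F 0 * F (b - a))
    ((measurable_pi_apply _).mul (measurable_pi_apply _))
  simpa only [zero_add, sub_add_cancel] using this

/-- A union bound. If the decoder errs although v passes the threshold, its output v' passes too, so
1 is at most the density of v' divided by T. The symmetry then replaces the pair of words by 0 and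
their difference. -/
theorem setIntegral_thresholdCode_le
    (E : (Fin k₁ → ZMod 2) →ₗ[ZMod 2] (Fin L × Fin n → ZMod 2)) {T : ℝ} (hT : 0 < T)
    (v : Fin k₁ → ZMod 2) :
    ∫ y in {y | (thresholdCode ch enc E T).decode y ≠ v}, ch.blockDensity enc (E v) y
      ∂(Measure.pi fun _ : Fin L × Fin n => ch.mixture) ≤
    ∫ y in {y | ch.blockDensity enc (E v) y < T}, ch.blockDensity enc (E v) y
      ∂(Measure.pi fun _ : Fin L × Fin n => ch.mixture) +
    ∑ v' ∈ Finset.univ.erase v, T⁻¹ *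
      ∫ y, ch.blockDensity enc 0 y * ch.blockDensity enc (E (v' - v)) y
        ∂(Measure.pi fun _ : Fin L × Fin n => ch.mixture) := by
  have hF := fun v => ch.isBoundedDensity_blockDensity enc (E v)
  have hm1 : MeasurableSet {y | (thresholdCode ch enc E T).decode y ≠ v} :=
    ((thresholdCode ch enc E T).measurableSet_decode v).compl
  have hm2 : MeasurableSet {y | ch.blockDensity enc (E v) y < T} :=
    measurableSet_lt (hF v).measurable measurable_const
  have hi : ∀ v', Integrable (fun y => T⁻¹ *
      (ch.blockDensity enc (E v) y * ch.blockDensity enc (E v') y))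
      (Measure.pi fun _ : Fin L × Fin n => ch.mixture) := fun v' =>
    ((hF v).integrable_mul (hF v')).const_mul _
  simp_rw [map_sub, ← integral_blockDensity_mul, ← integral_const_mul]
  rw [← integral_indicator hm1, ← integral_indicator hm2,
    ← integral_finsetSum _ fun v' _ => hi v',
    ← integral_add ((hF v).integrable.indicator hm2) (integrable_finsetSum _ fun v' _ => hi v')]
  refine integral_mono ((hF v).integrable.indicator hm1)
    (((hF v).integrable.indicator hm2).add (integrable_finsetSum _ fun v' _ => hi v')) fun y => ?_
  have hnn : ∀ v' ∈ Finset.univ.erase v, 0 ≤ T⁻¹ *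
      (ch.blockDensity enc (E v) y * ch.blockDensity enc (E v') y) := fun v' _ =>
    mul_nonneg (inv_nonneg.2 hT.le) (mul_nonneg ((hF v).nonneg y) ((hF v').nonneg y))
  dsimp only
  by_cases h1 : (thresholdCode ch enc E T).decode y = v
  · rw [Set.indicator_of_notMem (fun h => h h1 : y ∉ {y | (thresholdCode ch enc E T).decode y ≠ v})]
    exact add_nonneg (Set.indicator_nonneg (fun y _ => (hF v).nonneg y) y)
      (Finset.sum_nonneg hnn)
  rw [Set.indicator_of_mem (show y ∈ {y | (thresholdCode ch enc E T).decode y ≠ v} from h1)]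
  by_cases h2 : ch.blockDensity enc (E v) y < T
  · rw [Set.indicator_of_mem (show y ∈ {y | ch.blockDensity enc (E v) y < T} from h2)]
    exact le_add_of_nonneg_right (Finset.sum_nonneg hnn)
  have hex : ∃ v, T ≤ ch.blockDensity enc (E v) y := ⟨v, not_lt.1 h2⟩
  have hdec : (thresholdCode ch enc E T).decode y = hex.choose := dif_pos hex
  have hge : T ≤ ch.blockDensity enc (E ((thresholdCode ch enc E T).decode y)) y := by
    rw [hdec]
    exact hex.choose_spec
  refine le_add_of_nonneg_of_le (Set.indicator_nonneg (fun y _ => (hF v).nonneg y) y)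
    (le_trans ?_ (Finset.single_le_sum hnn (Finset.mem_erase.2 ⟨h1, Finset.mem_univ _⟩)))
  rw [inv_mul_eq_div, le_div_iff₀ hT]
  exact mul_le_mul_of_nonneg_left hge ((hF v).nonneg y)

/-- The image of v is uniform, and the densities of all words average to the constant 1, so the mean
of the integral is the total mass of the density at 0. -/
theorem sum_integral_blockDensity_mul {v : Fin k₁ → ZMod 2} (hv : v ≠ 0) :
    ∑ g : Fin k₁ → Fin L × Fin n → ZMod 2,
      ∫ y, ch.blockDensity enc 0 y *
        ch.blockDensity enc (Fintype.linearCombination (ZMod 2) g v) y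
        ∂(Measure.pi fun _ : Fin L × Fin n => ch.mixture) =
      Fintype.card (Fin k₁ → Fin L × Fin n → ZMod 2) := by
  have hF := fun w => ch.isBoundedDensity_blockDensity (L := L) enc w
  have h := card_mul_sum_linearCombination hv fun w : Fin L × Fin n → ZMod 2 =>
    ∫ y, ch.blockDensity enc 0 y * ch.blockDensity enc w y
      ∂(Measure.pi fun _ : Fin L × Fin n => ch.mixture)
  rw [← integral_finsetSum _ fun w _ => (hF 0).integrable_mul (hF w)] at h
  simp_rw [← Finset.mul_sum, ch.sum_blockDensity] at h
  rw [integral_mul_const, (hF 0).integral_eq_one, one_mul, mul_comm] at h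
  have hc : (Fintype.card (Fin L × Fin n → ZMod 2) : ℝ) = 2 ^ (L * n) := by simp
  rw [hc] at h
  exact mul_right_cancel₀ (by positivity) h

/-- Random coding over linear codes. -/
theorem exists_isLinear_errorRate_le {T ε : ℝ} (hT : 0 < T)
    (hε : ∀ w : Fin L × Fin n → ZMod 2,
      ∫ y in {y | ch.blockDensity enc w y < T}, ch.blockDensity enc w y
        ∂(Measure.pi fun _ : Fin L × Fin n => ch.mixture) ≤ ε)
    (hlt : ε + 2 ^ k₁ / T + 2 ^ k₁ / 2 ^ (L * n) < 1) :
    ∃ S : FreeRideCode n L k₁ Y, S.IsLinear ∧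
      S.errorRate ch enc ≤ ε + 2 ^ k₁ / T + 2 ^ k₁ / 2 ^ (L * n) := by
  classical
  set G := Fin k₁ → Fin L × Fin n → ZMod 2
  set N : ℝ := (Fintype.card G : ℝ) with hN
  have hNpos : 0 < N := by
    rw [hN]
    exact_mod_cast Fintype.card_pos
  let E : G → (Fin k₁ → ZMod 2) →ₗ[ZMod 2] (Fin L × Fin n → ZMod 2) :=
    fun g => Fintype.linearCombination (ZMod 2) g
  let err : G → ℝ := fun g => (thresholdCode ch enc (E g) T).errorRate ch enc
  -- The number of nonzero kernel vectors. Adding it to the error rate lets one averaging argument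
  -- secure both reliability and injectivity.
  let col : G → ℝ := fun g => ∑ v ∈ Finset.univ.erase (0 : Fin k₁ → ZMod 2),
    if E g v = 0 then 1 else 0
  have hcardV : ((Finset.univ : Finset (Fin k₁ → ZMod 2)).card : ℝ) = 2 ^ k₁ := by simp
  have hcarde : ∀ v, ((Finset.univ.erase v : Finset (Fin k₁ → ZMod 2)).card : ℝ) ≤ 2 ^ k₁ :=
    fun v => by
      rw [← hcardV]
      exact_mod_cast Finset.card_le_card (Finset.erase_subset _ _)
  have hcol : ∑ g, col g ≤ N * (2 ^ k₁ / 2 ^ (L * n)) := by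
    have h1 : ∀ v ∈ Finset.univ.erase (0 : Fin k₁ → ZMod 2),
        ∑ g, (if E g v = 0 then (1 : ℝ) else 0) = N / 2 ^ (L * n) := fun v hv => by
      have h := card_mul_sum_linearCombination (Finset.ne_of_mem_erase hv)
        fun w : Fin L × Fin n → ZMod 2 => if w = 0 then (1 : ℝ) else 0
      rw [Finset.sum_ite_eq' Finset.univ (0 : Fin L × Fin n → ZMod 2),
        if_pos (Finset.mem_univ _), mul_one] at h
      have hc : (Fintype.card (Fin L × Fin n → ZMod 2) : ℝ) = 2 ^ (L * n) := by simp
      rw [hc] at h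
      rw [eq_div_iff (by positivity), mul_comm]
      exact h
    simp only [col]
    rw [Finset.sum_comm, Finset.sum_congr rfl h1, Finset.sum_const, nsmul_eq_mul,
      mul_div_left_comm]
    exact mul_le_mul_of_nonneg_left
      (div_le_div_of_nonneg_right (hcarde 0) (by positivity)) hNpos.le
  have herr : ∑ g, err g ≤ N * (ε + 2 ^ k₁ / T) := by
    have h1 : ∀ g, err g ≤ (∑ v, (ε + ∑ v' ∈ Finset.univ.erase v, T⁻¹ *
        ∫ y, ch.blockDensity enc 0 y * ch.blockDensity enc (E g (v' - v)) y
          ∂(Measure.pi fun _ : Fin L × Fin n => ch.mixture))) / 2 ^ k₁ := fun g => by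
      simp only [err]
      rw [errorRate_eq]
      refine div_le_div_of_nonneg_right (Finset.sum_le_sum fun v _ => ?_) (by positivity)
      exact (setIntegral_thresholdCode_le ch enc (E g) hT v).trans
        (add_le_add_left (hε (E g v)) _)
    have h2 : ∀ v, ∑ g, (ε + ∑ v' ∈ Finset.univ.erase v, T⁻¹ *
        ∫ y, ch.blockDensity enc 0 y * ch.blockDensity enc (E g (v' - v)) y
          ∂(Measure.pi fun _ : Fin L × Fin n => ch.mixture)) ≤ N * (ε + 2 ^ k₁ / T) := fun v => by
      rw [Finset.sum_add_distrib, Finset.sum_comm]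
      have h3 : ∀ v' ∈ Finset.univ.erase v, ∑ g, T⁻¹ *
          ∫ y, ch.blockDensity enc 0 y * ch.blockDensity enc (E g (v' - v)) y
            ∂(Measure.pi fun _ : Fin L × Fin n => ch.mixture) = T⁻¹ * N := fun v' hv' => by
        rw [← Finset.mul_sum, sum_integral_blockDensity_mul ch enc
          (sub_ne_zero.2 (Finset.ne_of_mem_erase hv'))]
      rw [Finset.sum_congr rfl h3, Finset.sum_const, Finset.sum_const, nsmul_eq_mul, nsmul_eq_mul,
        mul_add]
      refine add_le_add le_rfl ?_
      calc _ ≤ 2 ^ k₁ * (T⁻¹ * N) := mul_le_mul_of_nonneg_right (hcarde v) (by positivity)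
        _ = _ := by ring
    calc ∑ g, err g ≤ _ := Finset.sum_le_sum fun g _ => h1 g
      _ = (∑ v, ∑ g, (ε + ∑ v' ∈ Finset.univ.erase v, T⁻¹ *
        ∫ y, ch.blockDensity enc 0 y * ch.blockDensity enc (E g (v' - v)) y
          ∂(Measure.pi fun _ : Fin L × Fin n => ch.mixture))) / 2 ^ k₁ := by
        rw [← Finset.sum_div, Finset.sum_comm]
      _ ≤ (∑ _v : Fin k₁ → ZMod 2, N * (ε + 2 ^ k₁ / T)) / 2 ^ k₁ :=
        div_le_div_of_nonneg_right (Finset.sum_le_sum fun v _ => h2 v) (by positivity)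
      _ = _ := by
        rw [Finset.sum_const, nsmul_eq_mul, hcardV, mul_div_cancel_left₀ _ (by positivity)]
  obtain ⟨g, -, hg⟩ := Finset.exists_le_of_sum_le (s := (Finset.univ : Finset G))
    (f := fun g => err g + col g) (g := fun _ => ε + 2 ^ k₁ / T + 2 ^ k₁ / 2 ^ (L * n))
    Finset.univ_nonempty (by
      rw [Finset.sum_add_distrib, Finset.sum_const, nsmul_eq_mul, Finset.card_univ, mul_add]
      exact add_le_add herr hcol)
  have herr0 : 0 ≤ err g := errorRate_nonneg ch enc _
  have hcol0 : 0 ≤ col g := Finset.sum_nonneg fun v _ => by split_ifs <;> norm_num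
  refine ⟨thresholdCode ch enc (E g) T, ⟨(E g).isLinear, ?_⟩, ?_⟩
  -- A nonzero kernel vector would make the count at least 1, while the chosen total is below 1.
  · refine (injective_iff_map_eq_zero (E g)).2 fun v hv => ?_
    by_contra hne
    have h1 := Finset.single_le_sum (s := Finset.univ.erase (0 : Fin k₁ → ZMod 2))
      (f := fun v => if E g v = 0 then (1 : ℝ) else 0)
      (fun v _ => by split_ifs <;> norm_num) (Finset.mem_erase.2 ⟨hne, Finset.mem_univ _⟩)
    simp only [if_pos hv] at h1
    have h2 : 1 ≤ col g := h1
    linarith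
  · change err g ≤ _
    linarith

/-- A filler of rate 1 with a trivial decoder, for those L at which the random coding bound says
nothing; its error rate is irrelevant in the limit. -/
theorem exists_isLinear_full : ∃ S : FreeRideCode n L (L * n) Y, S.IsLinear := by
  refine ⟨⟨fun v ti => v (finProdFinEquiv ti), fun _ => 0, fun v => MeasurableSet.const _⟩,
    ⟨fun _ _ => rfl, fun _ _ => rfl⟩, fun v w h => funext fun i => ?_⟩
  have := congrFun h (finProdFinEquiv.symm i)
  simpa only [Equiv.apply_symm_apply] using this

end FreeRideCode

/-! ### Accessible rates: converse and achievability. -/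

section Accessible

variable {Y : Type*} [MeasurableSpace Y] (ch : BIOSChannel Y) {n k : ℕ}
  {C₀ : Submodule (ZMod 2) (Fin n → ZMod 2)} (enc : (Fin k → ZMod 2) ≃ C₀)

theorem linearAccessibleRates_subset :
    linearAccessibleRates ch enc ⊆ accessibleRates ch enc :=
  fun _ ⟨k₁, S, _, h⟩ => ⟨k₁, S, h⟩

/-- The finite converse bound is divided by L; as the error rate tends to 0, the excess 1/L
disappears in the limit. -/
theorem le_of_mem_accessibleRates (hn : 0 < n) {R : ℝ} (hR : R ∈ accessibleRates ch enc) :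
    R ≤ densityEntropy (Measure.pi fun _ : Fin n => ch.mixture) (ch.payloadDensity enc) /
      (n * Real.log 2) := by
  obtain ⟨k₁, S, hrate, htend⟩ := hR
  set D := densityEntropy (Measure.pi fun _ : Fin n => ch.mixture) (ch.payloadDensity enc)
  have hlog := Real.log_pos one_lt_two
  have hn' : (0 : ℝ) < n := by exact_mod_cast hn
  have h1 : Tendsto (fun L => R * (n * Real.log 2) * (1 - (S L).errorRate ch enc)) atTop
      (𝓝 (R * (n * Real.log 2) * (1 - 0))) := (htend.const_sub 1).const_mul _
  have h2 : Tendsto (fun L : ℕ => D + 1 / (L : ℝ)) atTop (𝓝 (D + 0)) :=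
    tendsto_one_div_atTop_nhds_zero_nat.const_add D
  rw [sub_zero, mul_one] at h1
  rw [add_zero] at h2
  rw [le_div_iff₀ (by positivity)]
  refine le_of_tendsto_of_tendsto h1 h2 ?_
  filter_upwards [eventually_gt_atTop 0] with L hL
  have hL' : (0 : ℝ) < L := by exact_mod_cast hL
  have hk := hrate L hL
  rw [le_div_iff₀ (by positivity)] at hk
  have h3 := (S L).log_two_mul_le ch enc
  have h4 := (S L).one_sub_errorRate_nonneg ch enc
  have h5 : R * (n * L) * (Real.log 2 * (1 - (S L).errorRate ch enc)) ≤ L * D + 1 :=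
    (mul_le_mul_of_nonneg_right hk (mul_nonneg hlog.le h4)).trans (by rw [← mul_assoc]; exact h3)
  refine le_of_mul_le_mul_left ?_ hL'
  calc (L : ℝ) * (R * (n * Real.log 2) * (1 - (S L).errorRate ch enc))
      = R * (n * L) * (Real.log 2 * (1 - (S L).errorRate ch enc)) := by ring
    _ ≤ L * D + 1 := h5
    _ = L * (D + 1 / L) := by field_simp

/-- With no extra bits there is only one message, so no error can occur. -/
theorem mem_linearAccessibleRates_of_neg {R : ℝ} (hR : R < 0) :
    R ∈ linearAccessibleRates ch enc := by
  refine ⟨fun _ => 0, fun L => ⟨fun _ => 0, fun _ => 0, fun v => MeasurableSet.const _⟩,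
    fun L => ⟨⟨fun _ _ => (add_zero _).symm, fun _ _ => (smul_zero _).symm⟩,
      Function.injective_of_subsingleton _⟩, fun L _ => by simpa using hR.le, ?_⟩
  refine tendsto_const_nhds.congr fun L => ?_
  rw [FreeRideCode.errorRate, Finset.sum_eq_zero, zero_div]
  refine fun u _ => Finset.sum_eq_zero fun v _ => ?_
  convert! measureReal_empty
  exact Set.eq_empty_of_forall_notMem fun y hy => hy (Subsingleton.elim (α := Fin 0 → ZMod 2) _ _)

theorem mem_linearAccessibleRates (hn : 0 < n) {R : ℝ} (hR0 : 0 ≤ R)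
    (hR : R < densityEntropy (Measure.pi fun _ : Fin n => ch.mixture) (ch.payloadDensity enc) /
      (n * Real.log 2)) : R ∈ linearAccessibleRates ch enc := by
  obtain ⟨V, hV⟩ := ch.setIntegral_blockDensity_lt_le enc
  set D := densityEntropy (Measure.pi fun _ : Fin n => ch.mixture) (ch.payloadDensity enc)
  have hlog := Real.log_pos one_lt_two
  have hn' : (0 : ℝ) < n := by exact_mod_cast hn
  have hDle : D ≤ n * Real.log 2 := by
    simpa using (ch.isBoundedDensity_payloadDensity enc).densityEntropy_le
  have hRD : R * (n * Real.log 2) < D := (lt_div_iff₀ (by positivity)).1 hR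
  have hR1 : R ≤ 1 := hR.le.trans ((div_le_one (by positivity)).2 hDle)
  -- Half the gap in nats per block: the number of messages is about exp(L(D - 2δ)) and the
  -- threshold is exp(L(D - δ)), so either margin is δ.
  set δ := (D - R * (n * Real.log 2)) / 2 with hδ
  have hδ0 : 0 < δ := by rw [hδ]; linarith
  -- The terms bound the Chebyshev tail, the wrong words above the threshold, and the expected
  -- number of nonzero kernel vectors. The factor 2 pays for rounding up the number of extra bits.
  let b : ℕ → ℝ := fun L => V / (L * δ ^ 2) + 2 * Real.exp (-δ) ^ L + 2 * Real.exp (-δ) ^ L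
  have hb : Tendsto b atTop (𝓝 0) := by
    have h1 : Tendsto (fun L : ℕ => V / (L * δ ^ 2)) atTop (𝓝 0) :=
      tendsto_const_nhds.div_atTop
        (tendsto_natCast_atTop_atTop.atTop_mul_const (by positivity))
    have h2 := (tendsto_pow_atTop_nhds_zero_of_lt_one (Real.exp_pos (-δ)).le
      (Real.exp_lt_one_iff.2 (neg_lt_zero.2 hδ0))).const_mul 2
    simpa using (h1.add h2).add h2
  have key : ∀ L : ℕ, ∃ (k₁ : ℕ) (S : FreeRideCode n L k₁ Y), S.IsLinear ∧
      (0 < L → R ≤ (k₁ : ℝ) / (n * L)) ∧ (0 < L → b L < 1 → S.errorRate ch enc ≤ b L) := by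
    intro L
    by_cases h : 0 < L ∧ b L < 1
    · obtain ⟨hL, hbL⟩ := h
      have hL' : (0 : ℝ) < L := by exact_mod_cast hL
      set k₁ := ⌈R * (n * L)⌉₊
      have hk1 : R * (n * L) ≤ k₁ := Nat.le_ceil _
      have hk2 : (k₁ : ℝ) ≤ R * (n * L) + 1 := (Nat.ceil_lt_add_one (by positivity)).le
      have hM : (2 : ℝ) ^ k₁ ≤ 2 * Real.exp (L * (R * (n * Real.log 2))) := by
        rw [← Real.rpow_natCast, Real.rpow_def_of_pos two_pos]
        nth_rw 2 [← Real.exp_log two_pos]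
        rw [← Real.exp_add]
        refine Real.exp_le_exp.2 ?_
        nlinarith
      have hexp : Real.exp (-δ) ^ L = Real.exp (-(L * δ)) := by
        rw [← Real.exp_nat_mul, mul_neg]
      have hMT : (2 : ℝ) ^ k₁ / Real.exp (L * (D - δ)) ≤ 2 * Real.exp (-δ) ^ L := by
        rw [div_le_iff₀ (Real.exp_pos _), hexp, mul_assoc, ← Real.exp_add]
        refine hM.trans_eq ?_
        congr 2
        rw [hδ]
        ring
      -- Since D is at most n log 2, the threshold does not exceed the number of words, and the
      -- kernel term is no larger than the previous one.
      have hMN : (2 : ℝ) ^ k₁ / 2 ^ (L * n) ≤ 2 * Real.exp (-δ) ^ L := by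
        refine le_trans ?_ hMT
        refine div_le_div_of_nonneg_left (by positivity) (Real.exp_pos _) ?_
        rw [← Real.rpow_natCast, Real.rpow_def_of_pos two_pos]
        refine Real.exp_le_exp.2 ?_
        push_cast
        have : L * (D - δ) ≤ L * (n * Real.log 2) :=
          mul_le_mul_of_nonneg_left (by linarith) hL'.le
        linarith
      have hle : V / (L * δ ^ 2) + 2 ^ k₁ / Real.exp (L * (D - δ)) + 2 ^ k₁ / 2 ^ (L * n) ≤ b L :=
        add_le_add (add_le_add le_rfl hMT) hMN
      obtain ⟨S, hS, hSe⟩ := FreeRideCode.exists_isLinear_errorRate_le ch enc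
        (Real.exp_pos (L * (D - δ))) (hV L hL δ hδ0) (hle.trans_lt hbL)
      exact ⟨k₁, S, hS, fun _ => (le_div_iff₀ (by positivity)).2 hk1, fun _ _ => hSe.trans hle⟩
    -- Only L = 0 or finitely many small L arrive here; the filler meets the rate demand because R
    -- is at most 1.
    · obtain ⟨S, hS⟩ := FreeRideCode.exists_isLinear_full (n := n) (L := L) (Y := Y)
      refine ⟨L * n, S, hS, fun hL => ?_, fun hL hbL => absurd ⟨hL, hbL⟩ h⟩
      have hL' : (0 : ℝ) < L := by exact_mod_cast hL
      rw [le_div_iff₀ (by positivity)]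
      push_cast
      nlinarith [mul_pos hn' hL']
  choose k₁ S hS hrate herr using key
  refine ⟨k₁, S, hS, hrate, ?_⟩
  refine tendsto_of_tendsto_of_tendsto_of_le_of_le' tendsto_const_nhds hb
    (Eventually.of_forall fun L => (S L).errorRate_nonneg ch enc) ?_
  filter_upwards [eventually_gt_atTop 0, hb.eventually_lt_const one_pos] with L hL hbL
  exact herr L hL hbL

end Accessible

end FreeRide

/-- The accessible capacity, i.e. the supremum of all accessible rates, equals
`C_BIOS - I(C^n; Ỹ^n) / n`, whether arbitrary or only linear codes are admitted for the extra
bits. Both information quantities are finite. -/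
theorem theorem1 {Y : Type*} [MeasurableSpace Y] (ch : FreeRide.BIOSChannel Y)
    (n k : ℕ) (hn : 0 < n) (C₀ : Submodule (ZMod 2) (Fin n → ZMod 2))
    (hk : Module.finrank (ZMod 2) C₀ = k) (enc : (Fin k → ZMod 2) ≃ C₀) :
    ch.capacity ≠ ∞ ∧ ch.payloadInfo enc ≠ ∞ ∧
    IsLUB (FreeRide.accessibleRates ch enc)
      (ch.capacity.toReal - (ch.payloadInfo enc).toReal / n) ∧
    IsLUB (FreeRide.linearAccessibleRates ch enc)
      (ch.capacity.toReal - (ch.payloadInfo enc).toReal / n) := by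
  have hsub := FreeRide.linearAccessibleRates_subset ch enc
  have hub : ∀ R ∈ FreeRide.accessibleRates ch enc,
      R ≤ ch.capacity.toReal - (ch.payloadInfo enc).toReal / n := fun R hR =>
    (FreeRide.le_of_mem_accessibleRates ch enc hn hR).trans_eq
      (ch.capacity_sub_payloadInfo enc hn).symm
  have hach : ∀ R < ch.capacity.toReal - (ch.payloadInfo enc).toReal / n,
      R ∈ FreeRide.linearAccessibleRates ch enc := fun R hR => by
    rcases lt_or_ge R 0 with h | h
    · exact FreeRide.mem_linearAccessibleRates_of_neg ch enc h
    · exact FreeRide.mem_linearAccessibleRates ch enc hn h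
        (hR.trans_eq (ch.capacity_sub_payloadInfo enc hn))
  refine ⟨?_, ?_, ⟨hub, fun B hB => ?_⟩, ⟨fun R hR => hub R (hsub hR), fun B hB => ?_⟩⟩
  · rw [ch.capacity_eq]
    exact ENNReal.ofReal_ne_top
  · rw [ch.payloadInfo_eq enc]
    exact ENNReal.ofReal_ne_top
  · exact le_of_forall_lt_imp_le_of_dense fun R hR => hB (hsub (hach R hR))
  · exact le_of_forall_lt_imp_le_of_dense fun R hR => hB (hach R hR)
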